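/- **Theorem (Deformed quasi-Nambu–Goldstone theorem).** *Setting.* Let $G$ be a group acting on-site by unitaries $U_g$ on a finite-dimensional prototype spin $\mathbb C^p$, let $\psi\in\mathbb C^p$, and let $q$ be a complex linear combination of hermitian generators (hermitian $Q$ such that $e^{i\theta Q}\in U(G)$ for all $\theta\in\mathbb R$), e.g. a ladder operator. Let $\hat W_N$ be the periodic matrix-product operator on $N$ sites, from prototype spins $\mathbb C^p$ to physical spins $\mathbb C^d$, given by a tensor $W$ of bond dimension $\chi$. Put $A=W|\psi\rangle$, $B=W|q\psi\rangle$, and for tensors $X,Y$ let $T_{XY}=\sum_{l}\overline{X^l}\otimes Y^l$. Assume that the matrix-product state with tensor $A$ is injective (products of $L$ of the matrices $A^l$ span all $\chi\times\chi$ matrices for some $L\ge1$) and that its transfer matrix is normalized and has a unique dominant eigenvalue and no nontrivial Jordan blocks: $$T_{AA}=|R)(L|+\sum_{n=1}^{\chi^2-1}\lambda_n|r_n)(l_n|,\qquad |\lambda_n|<1,$$ with biorthonormal right and left eigenvectors. Let $h$ be a hermitian operator on $m+1$ physical sites and $H_N=\sum_{i=1}^N h_{[i,\dots,i+m]}$ the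 translation-invariant Hamiltonian on the periodic $N$-site chain. Assume that the deformed symmetric space is a degenerate scar space: for all $N>m$, $H_N$ acts as a real scalar $E_0(N)$ on $\operatorname{span}\{\hat W_N U_g^{\otimes N}\psi^{\otimes N}: g\in G\}$. For a nonzero crystal momentum $k$ of the $N$-site chain ($k=2\pi n/N$, $n\in\mathbb Z$, $N\nmid n$) let $$|\tilde k\rangle_N=\frac1{\mathcal N(N,k)}\sum_j e^{ikj}\,\hat W_N q_j\,\psi^{\otimes N},$$ where $\mathcal N(N,k)$ is the norm of the sum, and let $\varepsilon(N,k)=\langle\tilde k|H_N|\tilde k\rangle-E_0(N)$ and $\delta\varepsilon^2(N,k)=\langle\tilde k|H_N^2|\tilde k\rangle-\langle\tilde k|H_N|\tilde k\rangle^2$. Define, for $k\in\mathbb R$, $$\mathcal N_d(k)^2=(L|T_{BB}|R)-(L|T_{BA}|R)(L|T_{AB}|R)+\sum_{n=1}^{\chi^2-1}\left[\frac{(L|T_{BA}|r_n)(l_n|T_{AB}|R)}{e^{-ik}-\lambda_n}+\frac{(L|T_{AB}|r_n)(l_n|T_{BA}|R)}{e^{ik}-\lambda_n}\right].$$ *Conclusion.*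 In the following, $k_N$ is any sequence such that $k_N$ is a nonzero crystal momentum of the $N$-site chain for all large $N$ and $k_N\to k\in\mathbb R$. 1. $\mathcal N_d^2$ is continuous, real and nonnegative, and $\mathcal N(N,k_N)/\sqrt N\to\mathcal N_d(k)$ as $N\to\infty$, for every $k$. 2. There are functions $\varepsilon_k$, $\delta\varepsilon_k^2$ of $k$, continuous on $\{k\in\mathbb R:\mathcal N_d(k)\ne0\}$, such that for every $k$ in this set $\varepsilon(N,k_N)\to\varepsilon_k$ and $\delta\varepsilon^2(N,k_N)\to\delta\varepsilon^2_k$ as $N\to\infty$. 3. If $\mathcal N_d(0)\neq0$, then $\varepsilon_k\to0$ and $\delta\varepsilon^2_k\to0$ as $k\to0$. -/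

import Mathlib

open Filter Topology
open scoped Kronecker

noncomputable section

namespace DeformedScar

/-- The site at distance `a` to the right of `i` on the periodic chain with `N` sites. -/
def siteAdd {N : ℕ} (i : Fin N) (a : ℕ) : Fin N :=
  ⟨(i.val + a) % N, Nat.mod_lt _ (Nat.lt_of_le_of_lt (Nat.zero_le _) i.isLt)⟩

/-- The product state `ψ ⊗ ⋯ ⊗ ψ` on `N` sites, in the computational basis. -/
def productState {p : ℕ} (N : ℕ) (ψ : Fin p → ℂ) : (Fin N → Fin p) → ℂ :=
  fun s => ∏ i, ψ (s i)

/-- The onsite action `M ⊗ ⋯ ⊗ M` on `N` sites. -/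
def onsiteAction {p : ℕ} (N : ℕ) (M : Matrix (Fin p) (Fin p) ℂ) :
    Matrix (Fin N → Fin p) (Fin N → Fin p) ℂ :=
  Matrix.of fun s t => ∏ i, M (s i) (t i)

/-- The operator `q_j`: `q` acting on site `j`, the identity on all other sites. -/
def siteOp {p : ℕ} (N : ℕ) (q : Matrix (Fin p) (Fin p) ℂ) (j : Fin N) :
    Matrix (Fin N → Fin p) (Fin N → Fin p) ℂ :=
  open Classical in
  Matrix.of fun s t => if ∀ i, i ≠ j → s i = t i then q (s j) (t j) else 0

/-- The operator `h_{[i,…,i+m]}`: `h` acting on the `m + 1` consecutive sites starting at `i`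
(periodic boundary conditions), the identity on all other sites. It is used for `m < N`. -/
def blockOp {d m : ℕ} (N : ℕ) (h : Matrix (Fin (m + 1) → Fin d) (Fin (m + 1) → Fin d) ℂ)
    (i : Fin N) : Matrix (Fin N → Fin d) (Fin N → Fin d) ℂ :=
  open Classical in
  Matrix.of fun s t =>
    if ∀ x, (∀ a : Fin (m + 1), x ≠ siteAdd i a) → s x = t x then
      h (fun a => s (siteAdd i a)) (fun a => t (siteAdd i a))
    else 0

/-- The translation invariant local Hamiltonian `H = ∑ i, h_{[i,…,i+m]}` on the periodic chain. -/
def hamiltonian {d m : ℕ} (N : ℕ) (h : Matrix (Fin (m + 1) → Fin d) (Fin (m + 1) → Fin d) ℂ) :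
    Matrix (Fin N → Fin d) (Fin N → Fin d) ℂ :=
  ∑ i : Fin N, blockOp N h i

/-- The matrix-product operator with periodic boundary conditions and tensor `W`: `W l s` is the
bond matrix for the physical index `l` and the prototype index `s`. -/
def mpo {χ d p : ℕ} (N : ℕ) (W : Fin d → Fin p → Matrix (Fin χ) (Fin χ) ℂ) :
    Matrix (Fin N → Fin d) (Fin N → Fin p) ℂ :=
  Matrix.of fun l s => (List.ofFn fun i : Fin N => W (l i) (s i)).prod.trace

/-- The matrix-product-state tensor `W|ψ⟩`. -/
def mpsTensor {χ d p : ℕ} (W : Fin d → Fin p → Matrix (Fin χ) (Fin χ) ℂ) (ψ : Fin p → ℂ) :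
    Fin d → Matrix (Fin χ) (Fin χ) ℂ :=
  fun l => ∑ s, ψ s • W l s

/-- Injectivity of a matrix-product state (possibly after blocking finitely many sites): the
products of `L` matrices of the tensor span the whole matrix algebra, for some `L ≥ 1`. -/
def IsInjectiveMPS {χ d : ℕ} (A : Fin d → Matrix (Fin χ) (Fin χ) ℂ) : Prop :=
  ∃ L : ℕ, 0 < L ∧
    Submodule.span ℂ (Set.range fun s : Fin L → Fin d =>
      (List.ofFn fun i : Fin L => A (s i)).prod) = ⊤

/-- The (mixed) transfer matrix `X^* ⊗ Y` with bra tensor `X` and ket tensor `Y`, the physical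
index being contracted. -/
def transfer {χ d : ℕ} (X Y : Fin d → Matrix (Fin χ) (Fin χ) ℂ) :
    Matrix (Fin χ × Fin χ) (Fin χ × Fin χ) ℂ :=
  ∑ l, (X l).map (starRingEnd ℂ) ⊗ₖ (Y l)

/-- A spectral resolution `E = |R)(L| + ∑ n ≠ top, λ n |r n)(l n|` with biorthonormal eigenvectors
and `|λ n| < 1`: the matrix `E` has no nontrivial Jordan block, and its only dominant eigenvalue
is `1`, which is nondegenerate. -/
structure DominantResolution {ι : Type*} [Fintype ι] [DecidableEq ι] (E : Matrix ι ι ℂ) where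
  /-- The label of the dominant eigenvalue. -/
  top : ι
  /-- The eigenvalues, listed with multiplicity. -/
  ev : ι → ℂ
  /-- The right eigenvectors. -/
  right : ι → ι → ℂ
  /-- The left eigenvectors. -/
  left : ι → ι → ℂ
  biorthonormal : ∀ n n', left n ⬝ᵥ right n' = if n = n' then 1 else 0
  resolution : E = ∑ n, ev n • Matrix.vecMulVec (right n) (left n)
  ev_top : ev top = 1
  norm_ev_lt_one : ∀ n, n ≠ top → ‖ev n‖ < 1

/-- The tensor contraction `(l n| T |r n')`. -/
def DominantResolution.contract {ι : Type*} [Fintype ι] [DecidableEq ι] {E : Matrix ι ι ℂ}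
    (R : DominantResolution E) (n : ι) (T : Matrix ι ι ℂ) (n' : ι) : ℂ :=
  R.left n ⬝ᵥ (T.mulVec (R.right n'))

/-- The hermitian generators of the group of onsite symmetries `U g`: hermitian `Q` such that all
`exp (i θ Q)`, `θ` real, belong to the group. -/
def IsGenerator {G : Type*} [Group G] {p : ℕ} (U : G →* Matrix.unitaryGroup (Fin p) ℂ)
    (Q : Matrix (Fin p) (Fin p) ℂ) : Prop :=
  Q.IsHermitian ∧
    ∀ θ : ℝ, ∃ g, (U g : Matrix (Fin p) (Fin p) ℂ) = NormedSpace.exp ((Complex.I * θ) • Q)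

/-- The complexified Lie algebra of the onsite symmetry action; it contains the ladder operators. -/
def complexLieAlgebra {G : Type*} [Group G] {p : ℕ} (U : G →* Matrix.unitaryGroup (Fin p) ℂ) :
    Submodule ℂ (Matrix (Fin p) (Fin p) ℂ) :=
  Submodule.span ℂ {Q | IsGenerator U Q}

/-- The deformed symmetric space `span {Ŵ U_g^{⊗N} ψ^{⊗N} | g ∈ G}` on `N` sites. -/
def deformedSpace {G : Type*} [Group G] {χ d p : ℕ} (N : ℕ)
    (W : Fin d → Fin p → Matrix (Fin χ) (Fin χ) ℂ) (U : G →* Matrix.unitaryGroup (Fin p) ℂ)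
    (ψ : Fin p → ℂ) : Submodule ℂ ((Fin N → Fin d) → ℂ) :=
  Submodule.span ℂ (Set.range fun g : G =>
    (mpo N W).mulVec
      ((onsiteAction N (U g : Matrix (Fin p) (Fin p) ℂ)).mulVec (productState N ψ)))

/-- The twisted state before normalization, `∑ j, e^{ikj} Ŵ q_j ψ^{⊗N}`. -/
def twistedVec {χ d p : ℕ} (N : ℕ) (W : Fin d → Fin p → Matrix (Fin χ) (Fin χ) ℂ)
    (ψ : Fin p → ℂ) (q : Matrix (Fin p) (Fin p) ℂ) (k : ℝ) : (Fin N → Fin d) → ℂ :=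
  ∑ j : Fin N, Complex.exp (Complex.I * k * (j.val : ℂ)) •
    (mpo N W).mulVec ((siteOp N q j).mulVec (productState N ψ))

/-- The normalization factor: the Hilbert space norm of the twisted vector. -/
def normalization {χ d p : ℕ} (N : ℕ) (W : Fin d → Fin p → Matrix (Fin χ) (Fin χ) ℂ)
    (ψ : Fin p → ℂ) (q : Matrix (Fin p) (Fin p) ℂ) (k : ℝ) : ℝ :=
  Real.sqrt (star (twistedVec N W ψ q k) ⬝ᵥ twistedVec N W ψ q k).re

/-- The normalized twisted state `|k̃⟩`. -/
def twistedState {χ d p : ℕ} (N : ℕ) (W : Fin d → Fin p → Matrix (Fin χ) (Fin χ) ℂ)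
    (ψ : Fin p → ℂ) (q : Matrix (Fin p) (Fin p) ℂ) (k : ℝ) : (Fin N → Fin d) → ℂ :=
  ((normalization N W ψ q k : ℂ))⁻¹ • twistedVec N W ψ q k

/-- The expectation value `⟨v|O|v⟩` of a hermitian operator. -/
def expectation {ι : Type*} [Fintype ι] (O : Matrix ι ι ℂ) (v : ι → ℂ) : ℝ :=
  (star v ⬝ᵥ O.mulVec v).re

/-- The energy variance `⟨v|H²|v⟩ - ⟨v|H|v⟩²`. -/
def energyVariance {ι : Type*} [Fintype ι] (H : Matrix ι ι ℂ) (v : ι → ℂ) : ℝ :=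
  expectation (H * H) v - expectation H v ^ 2

/-- The nonzero crystal momenta `2πn/N` (`n` not divisible by `N`) of a periodic chain with `N`
sites. -/
def momenta (N : ℕ) : Set ℝ :=
  {k | ∃ n : ℤ, ¬ (N : ℤ) ∣ n ∧ k = 2 * Real.pi * n / N}

/-- The squared normalization per site `𝒩_d(k)²` as a finite tensor contraction, for the
tensors `A = W|ψ⟩` and `B = W q|ψ⟩`. -/
def normDensitySq {χ d : ℕ} (A B : Fin d → Matrix (Fin χ) (Fin χ) ℂ)
    (R : DominantResolution (transfer A A)) (k : ℝ) : ℂ :=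
  R.contract R.top (transfer B B) R.top
    - R.contract R.top (transfer B A) R.top * R.contract R.top (transfer A B) R.top
    + ∑ n ∈ Finset.univ.erase R.top,
        (R.contract R.top (transfer B A) n * R.contract n (transfer A B) R.top
            / (Complex.exp (-(Complex.I * k)) - R.ev n)
          + R.contract R.top (transfer A B) n * R.contract n (transfer B A) R.top
            / (Complex.exp (Complex.I * k) - R.ev n))

end DeformedScar

end

/-! Write `|A⟩` for the matrix-product state with tensor `A`. Since `A` is injective, replacing `A`
by `B` at one site is the same as acting on `|A⟩` with an operator `O` on finitely many sites
(`exists_localOp_of_isInjectiveMPS`). So the twisted state is, up to a phase, a momentum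
superposition of translates `O_j |A⟩`. As `|A⟩` is an eigenvector of `H` with eigenvalue `E₀`, `(H -
E₀) O_j |A⟩ = [H, O_j] |A⟩ = K_j |A⟩`, where `K` is again a local operator
(`dressedVec_localCommutator`). Norm, energy and variance thus reduce to overlaps of momentum
superpositions of local excitations of `|A⟩`.

By translation invariance such an overlap is `N` times a Fourier sum of a two-point function on the
ring. The spectral gap of the transfer matrix makes this function cluster exponentially
(`dressed_clusters`, `site_clusters`). At nonzero momentum the disconnected part sums to zero, being
multiplied by a full sum of powers of a nontrivial root of unity. Dominated convergence gives a
limit per site which is continuous in `k` (`Clusters.tendsto_sum`, `Clusters.continuous_ringSum`).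
For the norm, geometric series turn the limit into `𝒩_d(k)²`; for energy and variance it yields
functions `F` and `F'`, to be divided by `𝒩_d(k)²`.

It remains to see that `F` and `F'` vanish at `k = 0`. The untwisted vector `∑ j, Ŵ q_j ψ^{⊗N}` is a
complex combination of tangent vectors to the orbit, so it lies in the deformed space
(`sum_siteOp_mem_deformedSpace`) and `H - E₀` kills it. This concerns the momentum `0`, whereas `F`
is a limit along nonzero momenta, where the disconnected part drops out. The two agree because
`⟨A|K_j|A⟩ = 0` by hermiticity of `H`, so the disconnected part is itself zero. -/

noncomputable section

namespace DeformedScar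

/-! ### Operators acting on a subset of the sites. -/

section LocalOperators

variable {α ι κ μ : Type*}

/-- The operator `Z` acting on the sites in the range of `f`, the identity on all other sites. -/
def localOp (f : ι → κ) (Z : Matrix (ι → α) (ι → α) ℂ) : Matrix (κ → α) (κ → α) ℂ :=
  open Classical in
  Matrix.of fun s t => if ∀ x, (∀ a, x ≠ f a) → s x = t x then Z (s ∘ f) (t ∘ f) else 0

theorem extend_extend_self {f : ι → κ} (hf : f.Injective) (t u : ι → α) (s : κ → α) :
    Function.extend f t (Function.extend f u s) = Function.extend f t s := by
  funext x
  by_cases hx : ∃ a, f a = x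
  · obtain ⟨a, rfl⟩ := hx
    simp [hf.extend_apply]
  · simp [Function.extend_apply' _ _ _ hx]

theorem extend_extend_comm {f : ι → κ} {g : μ → κ} (hf : f.Injective) (hg : g.Injective)
    (hfg : ∀ a b, f a ≠ g b) (t : ι → α) (u : μ → α) (s : κ → α) :
    Function.extend f t (Function.extend g u s) = Function.extend g u (Function.extend f t s) := by
  funext x
  by_cases hx : ∃ a, f a = x
  · obtain ⟨a, rfl⟩ := hx
    have h : ¬ ∃ b, g b = f a := fun ⟨b, hb⟩ => hfg a b hb.symm
    simp [hf.extend_apply, Function.extend_apply' _ _ _ h]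
  · by_cases hy : ∃ b, g b = x
    · obtain ⟨b, rfl⟩ := hy
      simp [hg.extend_apply, Function.extend_apply' _ _ _ hx]
    · simp [Function.extend_apply' _ _ _ hx, Function.extend_apply' _ _ _ hy]

theorem extend_comp_of_disjoint {f : ι → κ} {g : μ → κ} (hfg : ∀ a b, f a ≠ g b) (t : ι → α)
    (s : κ → α) : Function.extend f t s ∘ g = s ∘ g := by
  funext b
  exact Function.extend_apply' _ _ _ fun ⟨a, ha⟩ => hfg a b ha

theorem localOp_sub (f : ι → κ) (X Y : Matrix (ι → α) (ι → α) ℂ) :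
    localOp f (X - Y) = localOp f X - localOp f Y := by
  ext s t
  simp only [localOp, Matrix.of_apply, Matrix.sub_apply]
  split_ifs <;> simp

theorem localOp_sum {β : Type*} (f : ι → κ) (S : Finset β) (X : β → Matrix (ι → α) (ι → α) ℂ) :
    localOp f (∑ b ∈ S, X b) = ∑ b ∈ S, localOp f (X b) := by
  ext s t
  simp only [localOp, Matrix.of_apply, Matrix.sum_apply]
  split_ifs <;> simp

theorem localOp_isHermitian (f : ι → κ) {Z : Matrix (ι → α) (ι → α) ℂ} (hZ : Z.IsHermitian) :
    (localOp f Z).IsHermitian := by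
  ext s t
  simp only [localOp, Matrix.conjTranspose_apply, Matrix.of_apply]
  have : (∀ x, (∀ a, x ≠ f a) → t x = s x) ↔ (∀ x, (∀ a, x ≠ f a) → s x = t x) :=
    forall_congr' fun _ => forall_congr' fun _ => eq_comm
  by_cases hst : ∀ x, (∀ a, x ≠ f a) → s x = t x
  · rw [if_pos hst, if_pos (this.2 hst)]
    exact hZ.apply _ _
  · rw [if_neg hst, if_neg (this.not.2 hst), star_zero]

variable [Fintype α] [Fintype ι] [DecidableEq ι] [Fintype κ] [DecidableEq κ]
  [Fintype μ] [DecidableEq μ]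

/-- The configurations that agree with `s` off the window are exactly the `Function.extend f t s`,
with `t` unique. The algebra of local operators thereby reduces to composition rules for
`Function.extend`. -/
theorem localOp_mulVec {f : ι → κ} (hf : f.Injective) (Z : Matrix (ι → α) (ι → α) ℂ)
    (v : (κ → α) → ℂ) (s : κ → α) :
    (localOp f Z).mulVec v s = ∑ t, Z (s ∘ f) t * v (Function.extend f t s) := by
  classical
  rw [Matrix.mulVec, dotProduct]
  refine (Fintype.sum_of_injective (fun t => Function.extend f t s)
    (Function.extend_injective hf s) _ _ ?_ ?_).symm
  · intro t ht
    rw [localOp, Matrix.of_apply, if_neg, zero_mul]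
    intro hst
    refine ht ⟨t ∘ f, funext fun x => ?_⟩
    by_cases hx : ∃ a, f a = x
    · obtain ⟨a, rfl⟩ := hx
      exact hf.extend_apply _ _ _
    · refine (Function.extend_apply' _ _ _ hx).trans ?_
      exact hst x fun a ha => hx ⟨a, ha.symm⟩
  · intro t
    rw [localOp, Matrix.of_apply, if_pos, Function.extend_comp hf]
    intro x hx
    rw [Function.extend_apply']
    rintro ⟨a, rfl⟩
    exact hx a rfl

theorem localOp_mul_mulVec {f : ι → κ} (hf : f.Injective) (X Y : Matrix (ι → α) (ι → α) ℂ)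
    (v : (κ → α) → ℂ) :
    (localOp f (X * Y)).mulVec v = (localOp f X).mulVec ((localOp f Y).mulVec v) := by
  funext s
  simp only [localOp_mulVec hf, Function.extend_comp hf, extend_extend_self hf, Matrix.mul_apply,
    Finset.sum_mul, Finset.mul_sum, mul_assoc]
  exact Finset.sum_comm

theorem localOp_comp_mulVec {f : ι → κ} {g : κ → μ} (hf : f.Injective) (hg : g.Injective)
    (Z : Matrix (ι → α) (ι → α) ℂ) (v : (μ → α) → ℂ) :
    (localOp g (localOp f Z)).mulVec v = (localOp (g ∘ f) Z).mulVec v := by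
  funext s
  rw [localOp_mulVec hg, localOp_mulVec (hg.comp hf)]
  have := localOp_mulVec hf Z (fun t => v (Function.extend g t s)) (s ∘ g)
  rw [Matrix.mulVec, dotProduct] at this
  rw [this]
  simp only [hf.extend_comp hg, Function.comp_assoc]

theorem localOp_commute_mulVec {f : ι → κ} {g : μ → κ} (hf : f.Injective) (hg : g.Injective)
    (hfg : ∀ a b, f a ≠ g b) (X : Matrix (ι → α) (ι → α) ℂ) (Y : Matrix (μ → α) (μ → α) ℂ)
    (v : (κ → α) → ℂ) :
    (localOp f X).mulVec ((localOp g Y).mulVec v) =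
      (localOp g Y).mulVec ((localOp f X).mulVec v) := by
  funext s
  simp only [localOp_mulVec hf, localOp_mulVec hg, Finset.mul_sum, extend_comp_of_disjoint hfg,
    extend_comp_of_disjoint fun b a => (hfg a b).symm, extend_extend_comm hf hg hfg]
  rw [Finset.sum_comm]
  exact Finset.sum_congr rfl fun _ _ => Finset.sum_congr rfl fun _ _ => by ring

end LocalOperators

theorem blockOp_eq_localOp {d m : ℕ} (N : ℕ)
    (h : Matrix (Fin (m + 1) → Fin d) (Fin (m + 1) → Fin d) ℂ) (i : Fin N) :
    blockOp N h i = localOp (fun a : Fin (m + 1) => siteAdd i a) h := by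
  ext s t
  simp only [blockOp, localOp, Matrix.of_apply]
  congr

/-! ### Words in the bond matrices, transfer matrices and overlaps. -/

section Words

variable {χ d : ℕ}

/-- The ordered product of site-dependent tensors along an open chain. -/
def siteWord {n : ℕ} (F : Fin n → Fin d → Matrix (Fin χ) (Fin χ) ℂ) (u : Fin n → Fin d) :
    Matrix (Fin χ) (Fin χ) ℂ :=
  (List.ofFn fun i => F i (u i)).prod

/-- The ordered product of the matrices of a tensor along an open chain. -/
def word {n : ℕ} (A : Fin d → Matrix (Fin χ) (Fin χ) ℂ) (u : Fin n → Fin d) :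
    Matrix (Fin χ) (Fin χ) ℂ :=
  siteWord (fun _ => A) u

theorem siteWord_append {n k : ℕ} (F : Fin (n + k) → Fin d → Matrix (Fin χ) (Fin χ) ℂ)
    (u : Fin n → Fin d) (v : Fin k → Fin d) :
    siteWord F (Fin.append u v) =
      siteWord (fun i => F (Fin.castAdd k i)) u * siteWord (fun i => F (Fin.natAdd n i)) v := by
  rw [siteWord, List.ofFn_add, List.prod_append]
  simp only [siteWord, Fin.append_right]
  congr 3
  funext i
  change F (Fin.castAdd k i) (Fin.append u v (Fin.castAdd k i)) = _
  rw [Fin.append_left]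

theorem word_append {n k : ℕ} (A : Fin d → Matrix (Fin χ) (Fin χ) ℂ)
    (u : Fin n → Fin d) (v : Fin k → Fin d) :
    word A (Fin.append u v) = word A u * word A v :=
  siteWord_append _ u v

/-- The transfer matrix of two families of bond matrices with the same physical index. -/
def mixedTransfer {ι : Type*} [Fintype ι] (F G : ι → Matrix (Fin χ) (Fin χ) ℂ) :
    Matrix (Fin χ × Fin χ) (Fin χ × Fin χ) ℂ :=
  ∑ u, (F u).map (starRingEnd ℂ) ⊗ₖ G u

/-- The trace of a Kronecker product is the product of the traces. Overlaps of periodic states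
become traces, which `mixedTransfer_append` factorizes along the arcs of the ring. -/
theorem trace_mixedTransfer {ι : Type*} [Fintype ι] (F G : ι → Matrix (Fin χ) (Fin χ) ℂ) :
    (mixedTransfer F G).trace = star (fun u => (F u).trace) ⬝ᵥ fun u => (G u).trace := by
  rw [mixedTransfer, Matrix.trace_sum, dotProduct]
  refine Finset.sum_congr rfl fun u _ => ?_
  rw [Matrix.trace_kronecker]
  congr 1
  simp [Matrix.trace]

theorem mixedTransfer_append {n k : ℕ} {F G : (Fin (n + k) → Fin d) → Matrix (Fin χ) (Fin χ) ℂ}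
    {F₁ G₁ : (Fin n → Fin d) → Matrix (Fin χ) (Fin χ) ℂ}
    {F₂ G₂ : (Fin k → Fin d) → Matrix (Fin χ) (Fin χ) ℂ}
    (hF : ∀ u v, F (Fin.append u v) = F₁ u * F₂ v) (hG : ∀ u v, G (Fin.append u v) = G₁ u * G₂ v) :
    mixedTransfer F G = mixedTransfer F₁ G₁ * mixedTransfer F₂ G₂ := by
  rw [mixedTransfer, ← (Fin.appendEquiv n k).sum_comp, Fintype.sum_prod_type, mixedTransfer,
    mixedTransfer, Finset.sum_mul_sum]
  refine Finset.sum_congr rfl fun u _ => Finset.sum_congr rfl fun v _ => ?_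
  rw [← Matrix.mul_kronecker_mul]
  change (F (Fin.append u v)).map _ ⊗ₖ G (Fin.append u v) = _
  rw [hF, hG, Matrix.map_mul]

theorem mixedTransfer_siteWord_one (F G : Fin 1 → Fin d → Matrix (Fin χ) (Fin χ) ℂ) :
    mixedTransfer (siteWord F) (siteWord G) = transfer (F 0) (G 0) := by
  rw [mixedTransfer, transfer, ← (Equiv.funUnique (Fin 1) (Fin d)).symm.sum_comp]
  refine Finset.sum_congr rfl fun l _ => ?_
  simp [siteWord]

theorem mixedTransfer_word (A : Fin d → Matrix (Fin χ) (Fin χ) ℂ) (n : ℕ) :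
    mixedTransfer (word A : (Fin n → Fin d) → _) (word A) = transfer A A ^ n := by
  induction n with
  | zero =>
    simp [mixedTransfer, word, siteWord]
  | succ n ih =>
    rw [mixedTransfer_append (word_append A) (word_append A), ih, pow_succ]
    congr 1
    exact mixedTransfer_siteWord_one _ _

/-- The bond matrices obtained by acting with `Z` on the sites in the range of `f` of an open chain
of tensors `A`. -/
def dressedWord {l n : ℕ} (A : Fin d → Matrix (Fin χ) (Fin χ) ℂ) (f : Fin l → Fin n)
    (Z : Matrix (Fin l → Fin d) (Fin l → Fin d) ℂ) (u : Fin n → Fin d) :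
    Matrix (Fin χ) (Fin χ) ℂ :=
  ∑ t, Z (u ∘ f) t • word A (Function.extend f t u)

theorem dressedWord_castAdd {l n : ℕ} (A : Fin d → Matrix (Fin χ) (Fin χ) ℂ) {f : Fin l → Fin n}
    (hf : f.Injective) (Z : Matrix (Fin l → Fin d) (Fin l → Fin d) ℂ) (k : ℕ)
    (u : Fin n → Fin d) (v : Fin k → Fin d) :
    dressedWord A (Fin.castAdd k ∘ f) Z (Fin.append u v) = dressedWord A f Z u * word A v := by
  rw [dressedWord, dressedWord, Finset.sum_mul]
  refine Finset.sum_congr rfl fun t _ => ?_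
  have h1 : Fin.append u v ∘ Fin.castAdd k = u := funext fun i => Fin.append_left u v i
  have h2 : Function.extend (Fin.castAdd k ∘ f) t (Fin.append u v) =
      Fin.append (Function.extend f t u) v := by
    rw [hf.extend_comp (Fin.castAdd_injective n k), h1]
    funext x
    refine Fin.addCases (fun i => ?_) (fun i => ?_) x
    · rw [(Fin.castAdd_injective n k).extend_apply, Fin.append_left]
    · rw [Function.extend_apply', Fin.append_right, Fin.append_right]
      rintro ⟨a, ha⟩
      have := congrArg Fin.val ha
      simp at this
      omega
  rw [h2, word_append, smul_mul_assoc, ← Function.comp_assoc, h1]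

theorem dressedWord_natAdd {l n : ℕ} (A : Fin d → Matrix (Fin χ) (Fin χ) ℂ) {f : Fin l → Fin n}
    (hf : f.Injective) (Z : Matrix (Fin l → Fin d) (Fin l → Fin d) ℂ) (k : ℕ)
    (u : Fin k → Fin d) (v : Fin n → Fin d) :
    dressedWord A (Fin.natAdd k ∘ f) Z (Fin.append u v) = word A u * dressedWord A f Z v := by
  rw [dressedWord, dressedWord, Finset.mul_sum]
  refine Finset.sum_congr rfl fun t _ => ?_
  have h1 : Fin.append u v ∘ Fin.natAdd k = v := funext fun i => Fin.append_right u v i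
  have h2 : Function.extend (Fin.natAdd k ∘ f) t (Fin.append u v) =
      Fin.append u (Function.extend f t v) := by
    rw [hf.extend_comp (Fin.natAdd_injective n k), h1]
    funext x
    refine Fin.addCases (fun i => ?_) (fun i => ?_) x
    · rw [Function.extend_apply', Fin.append_left, Fin.append_left]
      rintro ⟨a, ha⟩
      have := congrArg Fin.val ha
      simp at this
      omega
    · rw [(Fin.natAdd_injective n k).extend_apply, Fin.append_right]
  rw [h2, word_append, mul_smul_comm, ← Function.comp_assoc, h1]

/-- The matrix-product state with tensor `A` on the periodic chain with `N` sites. -/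
def mpsVec (N : ℕ) (A : Fin d → Matrix (Fin χ) (Fin χ) ℂ) : (Fin N → Fin d) → ℂ :=
  fun s => (word A s).trace

theorem localOp_mulVec_mpsVec {l N : ℕ} (A : Fin d → Matrix (Fin χ) (Fin χ) ℂ)
    {f : Fin l → Fin N} (hf : f.Injective) (Z : Matrix (Fin l → Fin d) (Fin l → Fin d) ℂ) :
    (localOp f Z).mulVec (mpsVec N A) = fun s => (dressedWord A f Z s).trace := by
  funext s
  rw [localOp_mulVec hf, dressedWord, Matrix.trace_sum]
  simp [mpsVec]

/-- Cyclic rotations of the arguments do not change the trace of an ordered product. -/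
theorem trace_prod_ofFn_siteAdd {N : ℕ} (F : Fin N → Matrix (Fin χ) (Fin χ) ℂ) (i : ℕ) :
    (List.ofFn fun x : Fin N => F (siteAdd x i)).prod.trace = (List.ofFn F).prod.trace := by
  have h : (List.ofFn fun x : Fin N => F (siteAdd x i)) = (List.ofFn F).rotate i := by
    refine List.ext_getElem (by simp) fun n h1 h2 => ?_
    rw [List.getElem_rotate]
    simp [siteAdd]
  rw [h, List.rotate_eq_drop_append_take_mod, List.prod_append, Matrix.trace_mul_comm,
    ← List.prod_append, List.take_append_drop]

end Words

/-! ### Spectral calculus and decay for the transfer matrix. -/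

namespace DominantResolution

variable {ι : Type*} [Fintype ι] [DecidableEq ι] {E : Matrix ι ι ℂ} (R : DominantResolution E)

/-- The spectral function `∑ n, f n |r n)(l n|`. -/
def spectralFun (f : ι → ℂ) : Matrix ι ι ℂ :=
  Matrix.of (fun i n => R.right n i) * Matrix.diagonal f * Matrix.of (fun n i => R.left n i)

/-- The projection `|R)(L|` onto the dominant eigenvector. -/
def proj : Matrix ι ι ℂ :=
  R.spectralFun (Pi.single R.top 1)

theorem left_mul_right :
    (Matrix.of (fun n i => R.left n i) : Matrix ι ι ℂ) * Matrix.of (fun i n => R.right n i) = 1 := by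
  ext n n'
  rw [Matrix.mul_apply, Matrix.one_apply]
  exact R.biorthonormal n n'

theorem spectralFun_mul (f g : ι → ℂ) :
    R.spectralFun f * R.spectralFun g = R.spectralFun (f * g) := by
  have h := R.left_mul_right
  simp only [spectralFun]
  generalize (Matrix.of (fun n i => R.left n i) : Matrix ι ι ℂ) = L at h ⊢
  generalize (Matrix.of (fun i n => R.right n i) : Matrix ι ι ℂ) = S at h ⊢
  calc S * Matrix.diagonal f * L * (S * Matrix.diagonal g * L)
      = S * Matrix.diagonal f * (L * S) * Matrix.diagonal g * L := by simp only [mul_assoc]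
    _ = _ := by
      rw [h, mul_one, mul_assoc S, Matrix.diagonal_mul_diagonal]
      rfl

/-- Biorthonormality gives a one-sided inverse; the matrices are square, so it is two-sided, which
is completeness of the eigenvectors. -/
theorem spectralFun_one : R.spectralFun 1 = 1 := by
  rw [spectralFun, show Matrix.diagonal (1 : ι → ℂ) = 1 from Matrix.diagonal_one, mul_one]
  exact mul_eq_one_comm.1 R.left_mul_right

theorem spectralFun_sub (f g : ι → ℂ) :
    R.spectralFun f - R.spectralFun g = R.spectralFun (f - g) := by
  simp only [spectralFun, ← sub_mul, ← mul_sub, Matrix.diagonal_sub]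
  rfl

theorem spectralFun_apply (f : ι → ℂ) (i j : ι) :
    R.spectralFun f i j = ∑ n, f n * (R.right n i * R.left n j) := by
  rw [spectralFun, Matrix.mul_apply]
  simp only [Matrix.mul_diagonal, Matrix.of_apply]
  exact Finset.sum_congr rfl fun n _ => by ring

theorem eq_spectralFun : E = R.spectralFun R.ev := by
  conv_lhs => rw [R.resolution]
  ext i j
  rw [spectralFun_apply]
  simp [Matrix.sum_apply, Matrix.vecMulVec_apply]

theorem pow_eq_spectralFun (a : ℕ) : E ^ a = R.spectralFun (R.ev ^ a) := by
  induction a with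
  | zero => rw [pow_zero, pow_zero, spectralFun_one]
  | succ a ih =>
    rw [pow_succ, pow_succ, ← spectralFun_mul, ← ih, ← R.eq_spectralFun]

theorem contract_mul_spectralFun_mul (S T : Matrix ι ι ℂ) (f : ι → ℂ) (n n' : ι) :
    R.contract n (S * R.spectralFun f * T) n' =
      ∑ k, f k * (R.contract n S k * R.contract k T n') := by
  have key : S * R.spectralFun f * T = ∑ k, f k • Matrix.vecMulVec (S.mulVec (R.right k))
      (Matrix.vecMul (R.left k) T) := by
    have : R.spectralFun f = ∑ k, f k • Matrix.vecMulVec (R.right k) (R.left k) := by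
      ext i j
      rw [spectralFun_apply]
      simp [Matrix.sum_apply, Matrix.vecMulVec_apply]
    rw [this, Finset.mul_sum, Finset.sum_mul]
    refine Finset.sum_congr rfl fun k _ => ?_
    rw [mul_smul_comm, smul_mul_assoc, Matrix.mul_vecMulVec, Matrix.vecMulVec_mul]
  rw [contract, key, Matrix.sum_mulVec, dotProduct_sum]
  refine Finset.sum_congr rfl fun k _ => ?_
  rw [Matrix.smul_mulVec, Matrix.vecMulVec_mulVec, dotProduct_smul, contract, contract,
    Matrix.dotProduct_mulVec (R.left k)]
  simp [mul_comm]

theorem trace_mul_proj (S : Matrix ι ι ℂ) : (S * R.proj).trace = R.contract R.top S R.top := by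
  have : R.proj = Matrix.vecMulVec (R.right R.top) (R.left R.top) := by
    ext i j
    rw [proj, spectralFun_apply, Finset.sum_eq_single R.top] <;>
      simp +contextual [Matrix.vecMulVec_apply]
  rw [this, Matrix.mul_vecMulVec, Matrix.trace_vecMulVec, dotProduct_comm, contract]

theorem trace_mul_proj_mul_proj (S T : Matrix ι ι ℂ) :
    (S * R.proj * T * R.proj).trace = R.contract R.top S R.top * R.contract R.top T R.top := by
  rw [trace_mul_proj, proj, contract_mul_spectralFun_mul, Finset.sum_eq_single R.top] <;>
    simp +contextual

attribute [local instance] Matrix.linftyOpNormedRing Matrix.linftyOpNormedAlgebra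

/-- The difference is the spectral function of `λ_n ^ a` with the dominant eigenvalue removed. -/
theorem exists_norm_pow_sub_proj_le :
    ∃ C ρ : ℝ, 0 ≤ C ∧ 0 < ρ ∧ ρ < 1 ∧ ∀ a : ℕ, ‖E ^ a - R.proj‖ ≤ C * ρ ^ a := by
  obtain ⟨ρ, hρ0, hρ1, hρ⟩ : ∃ ρ : ℝ, 0 < ρ ∧ ρ < 1 ∧ ∀ n, n ≠ R.top → ‖R.ev n‖ ≤ ρ := by
    have h := fun n (hn : n ≠ R.top) => exists_between (R.norm_ev_lt_one n hn)
    -- Starting the maximum at `1 / 2` keeps `ρ` positive even if all other eigenvalues vanish;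
    -- `exists_clusters` divides by powers of `ρ`.
    refine ⟨(Finset.univ.erase R.top).fold max (1 / 2) fun n => ‖R.ev n‖, ?_, ?_, ?_⟩
    · exact (Finset.lt_fold_max _).2 (Or.inl (by norm_num))
    · refine (Finset.fold_max_lt _).2 ⟨by norm_num, fun n hn => R.norm_ev_lt_one n ?_⟩
      exact Finset.ne_of_mem_erase hn
    · intro n hn
      exact (Finset.le_fold_max _).2 (Or.inr ⟨n, by simp [hn], le_rfl⟩)
  refine ⟨‖(Matrix.of (fun i n => R.right n i) : Matrix ι ι ℂ)‖ *
    ‖(Matrix.of (fun n i => R.left n i) : Matrix ι ι ℂ)‖, ρ, by positivity, hρ0, hρ1, fun a => ?_⟩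
  rw [R.pow_eq_spectralFun, proj, spectralFun_sub, spectralFun]
  have hd : ‖(Matrix.diagonal (R.ev ^ a - Pi.single R.top 1) : Matrix ι ι ℂ)‖ ≤ ρ ^ a := by
    rw [Matrix.linfty_opNorm_diagonal, pi_norm_le_iff_of_nonneg (by positivity)]
    intro n
    by_cases hn : n = R.top
    · subst hn
      simp [R.ev_top, hρ0.le]
    · simpa [hn] using pow_le_pow_left₀ (norm_nonneg _) (hρ n hn) a
  calc _ ≤ _ * ‖(Matrix.diagonal (R.ev ^ a - Pi.single R.top 1) : Matrix ι ι ℂ)‖ * _ :=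
        (norm_mul_le _ _).trans (mul_le_mul_of_nonneg_right (norm_mul_le _ _) (norm_nonneg _))
    _ ≤ _ * ρ ^ a * _ := by gcongr
    _ = _ := by ring

theorem norm_trace_le (M : Matrix ι ι ℂ) : ‖M.trace‖ ≤ Fintype.card ι * ‖M‖ := by
  have h : ∀ i, ‖M i i‖ ≤ ‖M‖ := fun i => by
    rw [Matrix.linfty_opNorm_def, ← coe_nnnorm, NNReal.coe_le_coe]
    exact (Finset.single_le_sum (f := fun j => ‖M i j‖₊) (fun _ _ => zero_le)
      (Finset.mem_univ i)).trans
      (Finset.le_sup (f := fun i => ∑ j, ‖M i j‖₊) (Finset.mem_univ i))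
  refine (norm_sum_le _ _).trans ((Finset.sum_le_sum fun i _ => h i).trans ?_)
  simp

theorem tendsto_trace_mul_pow (S : Matrix ι ι ℂ) :
    Tendsto (fun a : ℕ => (S * E ^ a).trace) atTop (𝓝 (R.contract R.top S R.top)) := by
  obtain ⟨C, ρ, hC, hρ0, hρ1, h⟩ := R.exists_norm_pow_sub_proj_le
  rw [← trace_mul_proj, tendsto_iff_norm_sub_tendsto_zero]
  refine squeeze_zero (g := fun a => Fintype.card ι * (‖S‖ * (C * ρ ^ a)))
    (fun _ => norm_nonneg _) (fun a => ?_) ?_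
  · rw [← Matrix.trace_sub, ← mul_sub]
    refine (norm_trace_le _).trans ?_
    gcongr
    exact (norm_mul_le _ _).trans (mul_le_mul_of_nonneg_left (h a) (norm_nonneg _))
  · simpa using (((tendsto_pow_atTop_nhds_zero_of_lt_one hρ0.le hρ1).const_mul C).const_mul
      ‖S‖).const_mul (Fintype.card ι : ℝ)

/-- Two insertions on a ring decouple exponentially fast in the lengths of both arcs. -/
theorem exists_norm_trace_sub_le :
    ∃ ρ : ℝ, 0 < ρ ∧ ρ < 1 ∧ ∀ S T : Matrix ι ι ℂ, ∃ C : ℝ, 0 ≤ C ∧ ∀ a b : ℕ,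
      ‖(S * E ^ a * T * E ^ b).trace - R.contract R.top S R.top * R.contract R.top T R.top‖ ≤
        C * (ρ ^ a + ρ ^ b) := by
  obtain ⟨C, ρ, hC, hρ0, hρ1, h⟩ := R.exists_norm_pow_sub_proj_le
  refine ⟨ρ, hρ0, hρ1, fun S T => ?_⟩
  have hE : ∀ b : ℕ, ‖E ^ b‖ ≤ C + ‖R.proj‖ := fun b => by
    have h1 := norm_add_le (E ^ b - R.proj) R.proj
    rw [sub_add_cancel] at h1
    have h2 : C * ρ ^ b ≤ C * 1 := mul_le_mul_of_nonneg_left (pow_le_one₀ hρ0.le hρ1.le) hC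
    linarith [h b]
  refine ⟨Fintype.card ι * (‖S‖ * ‖T‖ * C * (C + ‖R.proj‖)), by positivity, fun a b => ?_⟩
  -- Telescoping: the projection replaces the powers on the two arcs one at a time.
  have hsplit : S * E ^ a * T * E ^ b - S * R.proj * T * R.proj =
      S * (E ^ a - R.proj) * T * E ^ b + S * R.proj * T * (E ^ b - R.proj) := by
    simp only [mul_sub, sub_mul]
    abel
  rw [← trace_mul_proj_mul_proj, ← Matrix.trace_sub]
  rw [hsplit]
  refine (norm_trace_le _).trans ?_
  rw [mul_assoc (Fintype.card ι : ℝ)]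
  refine mul_le_mul_of_nonneg_left ?_ (Nat.cast_nonneg _)
  have n4 : ∀ X Y Z V : Matrix ι ι ℂ, ‖X * Y * Z * V‖ ≤ ‖X‖ * ‖Y‖ * ‖Z‖ * ‖V‖ := fun X Y Z V =>
    (norm_mul_le _ _).trans (mul_le_mul_of_nonneg_right ((norm_mul_le _ _).trans
      (mul_le_mul_of_nonneg_right (norm_mul_le _ _) (norm_nonneg _))) (norm_nonneg _))
  have e1 : ‖S * (E ^ a - R.proj) * T * E ^ b‖ ≤ ‖S‖ * (C * ρ ^ a) * ‖T‖ * (C + ‖R.proj‖) :=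
    (n4 _ _ _ _).trans (by gcongr; exacts [h a, hE b])
  have e2 : ‖S * R.proj * T * (E ^ b - R.proj)‖ ≤ ‖S‖ * (C + ‖R.proj‖) * ‖T‖ * (C * ρ ^ b) :=
    (n4 _ _ _ _).trans (by gcongr; exacts [by linarith, h b])
  refine (norm_add_le _ _).trans ((add_le_add e1 e2).trans (le_of_eq ?_))
  ring

end DominantResolution

/-! ### Fourier sums of clustering correlations. -/

/-- The thermodynamic limit of the Fourier sum over a ring of a two-point function with the limits
`Gp r` at distance `r` to the right and `Gm r` at distance `r + 1` to the left, and with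
disconnected part `c`. -/
def ringSum (Gp Gm : ℕ → ℂ) (c : ℂ) (k : ℝ) : ℂ :=
  (∑' r : ℕ, Complex.exp (Complex.I * k) ^ r * (Gp r - c)) +
    ∑' r : ℕ, Complex.exp (-(Complex.I * k)) ^ (r + 1) * (Gm r - c)

theorem norm_exp_I_mul (k : ℝ) : ‖Complex.exp (Complex.I * k)‖ = 1 := by
  rw [mul_comm]
  exact Complex.norm_exp_ofReal_mul_I k

theorem norm_exp_neg_I_mul (k : ℝ) : ‖Complex.exp (-(Complex.I * k))‖ = 1 := by
  rw [Complex.exp_neg, norm_inv, norm_exp_I_mul, inv_one]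

/-- A correlation function on rings of growing length, which clusters exponentially fast and has
pointwise limits. -/
structure Clusters (g : ℕ → ℕ → ℂ) (c : ℂ) (Gp Gm : ℕ → ℂ) (C ρ : ℝ) : Prop where
  rate_nonneg : 0 ≤ ρ
  rate_lt_one : ρ < 1
  const_nonneg : 0 ≤ C
  bound : ∀ᶠ N in atTop, ∀ r < N, ‖g N r - c‖ ≤ C * (ρ ^ r + ρ ^ (N - r))
  tendsto_right : ∀ r, Tendsto (fun N => g N r) atTop (𝓝 (Gp r))
  tendsto_left : ∀ r, Tendsto (fun N => g N (N - (r + 1))) atTop (𝓝 (Gm r))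

namespace Clusters

variable {g : ℕ → ℕ → ℂ} {c : ℂ} {Gp Gm : ℕ → ℂ} {C ρ : ℝ}

/-- Once `N > 2 r`, the arc of length `r` is the shorter one and its term dominates the other,
whence the factor `2`. -/
theorem norm_right_le (h : Clusters g c Gp Gm C ρ) (r : ℕ) : ‖Gp r - c‖ ≤ C * 2 * ρ ^ r := by
  refine le_of_tendsto ((h.tendsto_right r).sub_const c).norm ?_
  filter_upwards [h.bound, eventually_ge_atTop (2 * r + 1)] with N hN hr
  have : ρ ^ (N - r) ≤ ρ ^ r :=
    pow_le_pow_of_le_one h.rate_nonneg h.rate_lt_one.le (by omega)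
  have h1 := mul_le_mul_of_nonneg_left (add_le_add_right this (ρ ^ r)) h.const_nonneg
  linarith [hN r (by omega)]

theorem norm_left_le (h : Clusters g c Gp Gm C ρ) (r : ℕ) : ‖Gm r - c‖ ≤ C * 2 * ρ ^ r := by
  refine le_of_tendsto ((h.tendsto_left r).sub_const c).norm ?_
  filter_upwards [h.bound, eventually_ge_atTop (2 * r + 1)] with N hN hr
  have h2 : ρ ^ (N - (r + 1)) ≤ ρ ^ r :=
    pow_le_pow_of_le_one h.rate_nonneg h.rate_lt_one.le (by omega)
  have h3 : ρ ^ (N - (N - (r + 1))) ≤ ρ ^ r :=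
    pow_le_pow_of_le_one h.rate_nonneg h.rate_lt_one.le (by omega)
  have h1 := mul_le_mul_of_nonneg_left (add_le_add h2 h3) h.const_nonneg
  linarith [hN (N - (r + 1)) (by omega)]

theorem summable_bound (h : Clusters g c Gp Gm C ρ) : Summable fun r : ℕ => C * 2 * ρ ^ r :=
  (summable_geometric_of_lt_one h.rate_nonneg h.rate_lt_one).mul_left _

theorem continuous_ringSum (h : Clusters g c Gp Gm C ρ) : Continuous (ringSum Gp Gm c) := by
  refine (continuous_tsum (fun r => by fun_prop) h.summable_bound fun r k => ?_).add
    (continuous_tsum (fun r => by fun_prop) h.summable_bound fun r k => ?_)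
  · rw [norm_mul, norm_pow, norm_exp_I_mul, one_pow, one_mul]
    exact h.norm_right_le r
  · rw [norm_mul, norm_pow, norm_exp_neg_I_mul, one_pow, one_mul]
    exact h.norm_left_le r

/-- The ring is cut at `N / 2`, and the far half is indexed by the distance to the left. On each
half the distance is that of the shorter arc, up to one site, so a summable geometric bound
independent of `N` permits dominated convergence. -/
theorem tendsto_sum (h : Clusters g c Gp Gm C ρ) {κ : ℕ → ℝ} {k : ℝ}
    (hκ : ∀ᶠ N in atTop, Complex.exp (Complex.I * κ N) ^ N = 1) (hk : Tendsto κ atTop (𝓝 k)) :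
    Tendsto (fun N => ∑ r ∈ Finset.range N, Complex.exp (Complex.I * κ N) ^ r * (g N r - c)) atTop
      (𝓝 (ringSum Gp Gm c k)) := by
  have hexp : Tendsto (fun N => Complex.exp (Complex.I * κ N)) atTop
      (𝓝 (Complex.exp (Complex.I * k))) := by
    have : Continuous fun x : ℝ => Complex.exp (Complex.I * x) := by fun_prop
    exact (this.tendsto k).comp hk
  have hexp' : Tendsto (fun N => Complex.exp (-(Complex.I * κ N))) atTop
      (𝓝 (Complex.exp (-(Complex.I * k)))) := by
    have : Continuous fun x : ℝ => Complex.exp (-(Complex.I * x)) := by fun_prop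
    exact (this.tendsto k).comp hk
  have hR : Tendsto (fun N => ∑' r : ℕ, if r < N / 2 then
      Complex.exp (Complex.I * κ N) ^ r * (g N r - c) else 0) atTop
      (𝓝 (∑' r : ℕ, Complex.exp (Complex.I * k) ^ r * (Gp r - c))) := by
    refine tendsto_tsum_of_dominated_convergence h.summable_bound (fun r => ?_) ?_
    · refine ((hexp.pow r).mul ((h.tendsto_right r).sub_const c)).congr' ?_
      filter_upwards [eventually_ge_atTop (2 * r + 2)] with N hN
      rw [if_pos (by omega)]
    · filter_upwards [h.bound] with N hN r
      split_ifs with hr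
      · rw [norm_mul, norm_pow, norm_exp_I_mul, one_pow, one_mul]
        have : ρ ^ (N - r) ≤ ρ ^ r :=
          pow_le_pow_of_le_one h.rate_nonneg h.rate_lt_one.le (by omega)
        have h1 := mul_le_mul_of_nonneg_left (add_le_add_right this (ρ ^ r)) h.const_nonneg
        linarith [hN r (by omega)]
      · rw [norm_zero]
        have := h.const_nonneg
        have := h.rate_nonneg
        positivity
  have hL : Tendsto (fun N => ∑' r : ℕ, if r < N - N / 2 then
      Complex.exp (-(Complex.I * κ N)) ^ (r + 1) * (g N (N - (r + 1)) - c) else 0) atTop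
      (𝓝 (∑' r : ℕ, Complex.exp (-(Complex.I * k)) ^ (r + 1) * (Gm r - c))) := by
    refine tendsto_tsum_of_dominated_convergence h.summable_bound (fun r => ?_) ?_
    · refine ((hexp'.pow (r + 1)).mul ((h.tendsto_left r).sub_const c)).congr' ?_
      filter_upwards [eventually_ge_atTop (2 * r + 2)] with N hN
      rw [if_pos (by omega)]
    · filter_upwards [h.bound] with N hN r
      split_ifs with hr
      · rw [norm_mul, norm_pow, norm_exp_neg_I_mul, one_pow, one_mul]
        have h2 : ρ ^ (N - (r + 1)) ≤ ρ ^ r :=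
          pow_le_pow_of_le_one h.rate_nonneg h.rate_lt_one.le (by omega)
        have h3 : ρ ^ (N - (N - (r + 1))) ≤ ρ ^ r :=
          pow_le_pow_of_le_one h.rate_nonneg h.rate_lt_one.le (by omega)
        have h1 := mul_le_mul_of_nonneg_left (add_le_add h2 h3) h.const_nonneg
        linarith [hN (N - (r + 1)) (by omega)]
      · rw [norm_zero]
        have := h.const_nonneg
        have := h.rate_nonneg
        positivity
  refine (hR.add hL).congr' ?_
  filter_upwards [hκ] with N hN
  have htsum : ∀ (n : ℕ) (f : ℕ → ℂ), (∑' r : ℕ, if r < n then f r else 0) =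
      ∑ r ∈ Finset.range n, f r := fun n f => by
    rw [tsum_eq_sum (s := Finset.range n) fun r hr => if_neg (by simpa using hr)]
    exact Finset.sum_congr rfl fun r hr => if_pos (by simpa using hr)
  rw [htsum, htsum]
  have hsplit : N = N / 2 + (N - N / 2) := by omega
  conv_rhs => rw [hsplit, Finset.sum_range_add, ← hsplit]
  congr 1
  rw [← Finset.sum_range_reflect]
  refine Finset.sum_congr rfl fun r hr => ?_
  have hr' : r < N - N / 2 := by simpa using hr
  have e1 : N - N / 2 - 1 - r + 1 = N - (N / 2 + r) := by omega
  have e2 : N - (N - (N / 2 + r)) = N / 2 + r := by omega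
  rw [e1, e2]
  congr 1
  -- Periodicity of the phase, `w ^ N = 1`, converts a phase to the right into the inverse phase
  -- over the complementary arc.
  rw [Complex.exp_neg, inv_pow]
  refine inv_eq_of_mul_eq_one_right ?_
  rw [← pow_add, show N - (N / 2 + r) + (N / 2 + r) = N by omega, hN]

end Clusters

/-! ### Translation covariance on the ring. -/

section Translations

theorem siteAdd_siteAdd {N : ℕ} (i : Fin N) (a b : ℕ) :
    siteAdd (siteAdd i a) b = siteAdd i (a + b) := by
  ext
  simp [siteAdd, add_assoc]

theorem siteAdd_right_comm {N : ℕ} (i : Fin N) (a b : ℕ) :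
    siteAdd (siteAdd i a) b = siteAdd (siteAdd i b) a := by
  rw [siteAdd_siteAdd, siteAdd_siteAdd, add_comm]

theorem siteAdd_injective {N : ℕ} (n : ℕ) : Function.Injective fun i : Fin N => siteAdd i n := by
  intro i j hij
  have h := congrArg Fin.val hij
  simp only [siteAdd] at h
  have h2 : i.val ≡ j.val [MOD N] := Nat.ModEq.add_right_cancel' n h
  exact Fin.ext (by rwa [Nat.ModEq, Nat.mod_eq_of_lt i.isLt, Nat.mod_eq_of_lt j.isLt] at h2)

/-- The translation of the ring by `n` sites. -/
def shift (N n : ℕ) : Equiv.Perm (Fin N) :=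
  Equiv.ofBijective (fun i => siteAdd i n) (Finite.injective_iff_bijective.1 (siteAdd_injective n))

theorem window_injective {l N : ℕ} (hl : l ≤ N) (i : Fin N) :
    Function.Injective fun a : Fin l => siteAdd i a := by
  intro a b hab
  have h := congrArg Fin.val hab
  simp only [siteAdd] at h
  have h2 : a.val ≡ b.val [MOD N] := Nat.ModEq.add_left_cancel' i.val h
  exact Fin.ext (by
    rwa [Nat.ModEq, Nat.mod_eq_of_lt (a.isLt.trans_le hl), Nat.mod_eq_of_lt (b.isLt.trans_le hl)]
      at h2)

/-- A family of states labelled by the sites of a ring which are translates of one another. -/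
def IsCovariant {α : Type*} {N : ℕ} (V : Fin N → (Fin N → α) → ℂ) : Prop :=
  ∀ i n s, V (siteAdd i n) s = V i fun x => s (siteAdd x n)

/-- The overlap of the first state of a family with the state at site `r` of another family. -/
def corr {α : Type*} [Fintype α] {N : ℕ} (X Y : Fin N → (Fin N → α) → ℂ) (r : ℕ) : ℂ :=
  if h : r < N then star (X ⟨0, r.zero_le.trans_lt h⟩) ⬝ᵥ Y ⟨r, h⟩ else 0

/-- The superposition with momentum `k` of a family of states. -/
def fourierVec {α : Type*} {N : ℕ} (k : ℝ) (V : Fin N → (Fin N → α) → ℂ) : (Fin N → α) → ℂ :=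
  ∑ j, Complex.exp (Complex.I * k) ^ j.val • V j

variable {α : Type*} {N : ℕ} {X Y V : Fin N → (Fin N → α) → ℂ}

theorem exp_pow_siteAdd {k : ℝ} (hk : Complex.exp (Complex.I * k) ^ N = 1) (j : Fin N) (n : ℕ) :
    Complex.exp (Complex.I * k) ^ (siteAdd j n).val =
      Complex.exp (Complex.I * k) ^ j.val * Complex.exp (Complex.I * k) ^ n := by
  rw [← pow_add, siteAdd]
  exact (pow_eq_pow_mod _ hk).symm

theorem fourierVec_shift {k : ℝ} (hk : Complex.exp (Complex.I * k) ^ N = 1) (n : ℕ) :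
    fourierVec k V =
      Complex.exp (Complex.I * k) ^ n • fourierVec k fun j => V (siteAdd j n) := by
  rw [fourierVec, ← Equiv.sum_comp (shift N n), fourierVec, Finset.smul_sum]
  refine Finset.sum_congr rfl fun j _ => ?_
  change Complex.exp (Complex.I * k) ^ (siteAdd j n).val • V (siteAdd j n) = _
  rw [exp_pow_siteAdd hk, smul_smul, mul_comm]

variable [Fintype α]

theorem IsCovariant.dotProduct_siteAdd (hX : IsCovariant X) (hY : IsCovariant Y) (i j : Fin N)
    (n : ℕ) : star (X (siteAdd i n)) ⬝ᵥ Y (siteAdd j n) = star (X i) ⬝ᵥ Y j := by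
  rw [dotProduct, dotProduct,
    ← (((shift N n).symm).arrowCongr (Equiv.refl α)).sum_comp fun s => star (X i) s * Y j s]
  refine Finset.sum_congr rfl fun s _ => ?_
  rw [Pi.star_apply, Pi.star_apply, hX, hY]
  rfl

/-- Translating by `i` shows that the sum over `j` is the same for every bra site `i`: the phases at
`i` cancel because `w ^ N = 1` and `|w| = 1`. Hence `N` equal terms. -/
theorem IsCovariant.dotProduct_fourierVec (hX : IsCovariant X) (hY : IsCovariant Y) {k : ℝ}
    (hk : Complex.exp (Complex.I * k) ^ N = 1) :
    star (fourierVec k X) ⬝ᵥ fourierVec k Y =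
      N * ∑ r ∈ Finset.range N, Complex.exp (Complex.I * k) ^ r * corr X Y r := by
  have hw : star (Complex.exp (Complex.I * k)) * Complex.exp (Complex.I * k) = 1 := by
    rw [Complex.star_def, Complex.conj_mul', norm_exp_I_mul]
    simp
  have key : ∀ i : Fin N, ∑ j : Fin N, Complex.exp (Complex.I * k) ^ j.val *
      (star (Complex.exp (Complex.I * k) ^ i.val) * (star (X i) ⬝ᵥ Y j)) =
      ∑ r ∈ Finset.range N, Complex.exp (Complex.I * k) ^ r * corr X Y r := by
    intro i
    rw [← Equiv.sum_comp (shift N i), Finset.sum_range]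
    refine Finset.sum_congr rfl fun r _ => ?_
    change _ ^ (siteAdd r i).val * (_ * (star (X i) ⬝ᵥ Y (siteAdd r i))) = _
    have hi : i = siteAdd (⟨0, r.val.zero_le.trans_lt r.isLt⟩ : Fin N) i := by
      ext
      simp [siteAdd, Nat.mod_eq_of_lt i.isLt]
    have hd : star (X i) ⬝ᵥ Y (siteAdd r i) = corr X Y r := by
      conv_lhs => rw [hi]
      rw [← hi, corr, dif_pos r.isLt]
      conv_lhs => enter [1, 1]; rw [hi]
      exact hX.dotProduct_siteAdd hY _ _ _
    rw [hd, exp_pow_siteAdd hk, star_pow]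
    have := congrArg (· ^ i.val) hw
    simp only [mul_pow, one_pow] at this
    linear_combination (Complex.exp (Complex.I * k) ^ r.val * corr X Y r) * this
  rw [fourierVec, fourierVec, star_sum, sum_dotProduct]
  simp only [dotProduct_sum, star_smul, smul_dotProduct, dotProduct_smul, smul_eq_mul]
  rw [Finset.sum_congr rfl fun i _ => key i]
  simp

theorem IsCovariant.corr_sub (hX : IsCovariant X) (hY : IsCovariant Y) {r : ℕ} (hr : r + 1 < N) :
    corr X Y (N - (r + 1)) = star (X ⟨r + 1, hr⟩) ⬝ᵥ Y ⟨0, r.succ.zero_le.trans_lt hr⟩ := by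
  rw [corr, dif_pos (by omega), ← hX.dotProduct_siteAdd hY _ _ (r + 1)]
  congr 2
  · congr 1
    ext
    simp [siteAdd, Nat.mod_eq_of_lt hr]
  · ext
    simp [siteAdd, show N - (r + 1) + (r + 1) = N by omega]

end Translations

/-! ### Crystal momenta. -/

section Momenta

theorem exp_pow_of_mem_momenta {N : ℕ} (hN : N ≠ 0) {k : ℝ} (hk : k ∈ momenta N) :
    Complex.exp (Complex.I * k) ^ N = 1 := by
  obtain ⟨n, -, rfl⟩ := hk
  rw [← Complex.exp_nat_mul, Complex.exp_eq_one_iff]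
  refine ⟨n, ?_⟩
  push_cast
  field_simp

theorem exp_ne_one_of_mem_momenta {N : ℕ} (hN : N ≠ 0) {k : ℝ} (hk : k ∈ momenta N) :
    Complex.exp (Complex.I * k) ≠ 1 := by
  obtain ⟨n, hn, rfl⟩ := hk
  rw [Ne, Complex.exp_eq_one_iff]
  rintro ⟨z, hz⟩
  refine hn ⟨z, ?_⟩
  have hπ := Complex.ofReal_ne_zero.2 Real.pi_ne_zero
  have hN' : (N : ℂ) ≠ 0 := Nat.cast_ne_zero.2 hN
  push_cast at hz
  field_simp at hz
  have : (n : ℂ) = N * z := by linear_combination hz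
  exact_mod_cast this

/-- Every real `k` is approached by nonzero momenta, so properties of finite chains can be passed to
the limit at every `k`. -/
theorem exists_momenta_tendsto (k : ℝ) : ∃ κ : ℕ → ℝ, (∀ᶠ N in atTop, κ N ∈ momenta N) ∧
    Tendsto κ atTop (𝓝 k) := by
  have h2π : (0 : ℝ) < 2 * Real.pi := by positivity
  have h : ∀ N : ℕ, ∃ x : ℝ, 2 ≤ N → x ∈ momenta N ∧ |x - k| ≤ 4 * Real.pi / N := by
    intro N
    by_cases hN : 2 ≤ N
    swap
    · exact ⟨0, fun h => absurd h hN⟩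
    have hN0 : (0 : ℝ) < N := by positivity
    obtain ⟨n, hn, hn'⟩ : ∃ n : ℤ, ¬ (N : ℤ) ∣ n ∧ |(n : ℝ) - k * N / (2 * Real.pi)| ≤ 2 := by
      have h1 := Int.floor_le (k * N / (2 * Real.pi))
      have h2 := Int.lt_floor_add_one (k * N / (2 * Real.pi))
      -- If rounding down hits a multiple of `N`, the next integer is not one, as `N ≥ 2`.
      by_cases hd : (N : ℤ) ∣ ⌊k * N / (2 * Real.pi)⌋
      · refine ⟨⌊k * N / (2 * Real.pi)⌋ + 1, fun h => ?_, ?_⟩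
        · have := Int.le_of_dvd one_pos ((Int.dvd_add_right hd).1 h)
          omega
        · push_cast
          rw [abs_le]
          constructor <;> linarith
      · refine ⟨_, hd, ?_⟩
        rw [abs_le]
        constructor <;> linarith
    refine ⟨2 * Real.pi * n / N, fun _ => ⟨⟨n, hn, rfl⟩, ?_⟩⟩
    have : 2 * Real.pi * n / N - k = 2 * Real.pi / N * (n - k * N / (2 * Real.pi)) := by
      field_simp
    rw [this, abs_mul, abs_of_pos (by positivity)]
    calc _ ≤ 2 * Real.pi / N * 2 := by gcongr
      _ = _ := by ring
  choose κ hκ using h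
  refine ⟨κ, ?_, ?_⟩
  · filter_upwards [eventually_ge_atTop 2] with N hN
    exact (hκ N hN).1
  · rw [tendsto_iff_norm_sub_tendsto_zero]
    refine squeeze_zero' (Eventually.of_forall fun _ => norm_nonneg _) ?_
      (tendsto_const_div_atTop_nhds_zero_nat (4 * Real.pi))
    filter_upwards [eventually_ge_atTop 2] with N hN
    exact (hκ N hN).2

end Momenta

/-! ### Overlaps of momentum states in the thermodynamic limit. -/

section ThermodynamicLimit

/-- For `w ≠ 1` with `w ^ N = 1` the geometric sum vanishes, so subtracting `c` costs nothing. At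
zero momentum this fails, and `c = 0` must be supplied. -/
theorem Clusters.tendsto_dotProduct_fourierVec {α : Type*} [Fintype α]
    {X Y : ∀ N : ℕ, Fin N → (Fin N → α) → ℂ} {c : ℂ} {Gp Gm : ℕ → ℂ} {C ρ : ℝ}
    (h : Clusters (fun N => corr (X N) (Y N)) c Gp Gm C ρ)
    (hX : ∀ᶠ N in atTop, IsCovariant (X N)) (hY : ∀ᶠ N in atTop, IsCovariant (Y N))
    {κ : ℕ → ℝ} {k : ℝ}
    (hκ : ∀ᶠ N in atTop, Complex.exp (Complex.I * κ N) ^ N = 1)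
    (hκ' : ∀ᶠ N in atTop, Complex.exp (Complex.I * κ N) = 1 → c = 0)
    (hk : Tendsto κ atTop (𝓝 k)) :
    Tendsto (fun N : ℕ => (star (fourierVec (κ N) (X N)) ⬝ᵥ fourierVec (κ N) (Y N)) / N) atTop
      (𝓝 (ringSum Gp Gm c k)) := by
  refine (h.tendsto_sum hκ hk).congr' ?_
  filter_upwards [hX, hY, hκ, hκ', eventually_ne_atTop 0] with N hX hY hκ hκ' hN
  rw [hX.dotProduct_fourierVec hY hκ, mul_div_cancel_left₀ _ (Nat.cast_ne_zero.2 hN)]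
  simp only [mul_sub, Finset.sum_sub_distrib, ← Finset.sum_mul]
  rw [sub_eq_self]
  by_cases hw : Complex.exp (Complex.I * κ N) = 1
  · rw [hκ' hw, mul_zero]
  · rw [geom_sum_eq hw, hκ, sub_self, zero_div, zero_mul]

/-- Decay is available only for disjoint windows of length `l`. The finitely many short distances on
either side are controlled by convergence: eventually each deviation is within `1` of its limit. The
factor `(ρ ^ l)⁻¹` makes the geometric bound at least the constant `D` there. -/
theorem exists_clusters {g : ℕ → ℕ → ℂ} {c : ℂ} {Gp Gm : ℕ → ℂ} {C ρ : ℝ} {l : ℕ} (hρ0 : 0 < ρ)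
    (hρ1 : ρ < 1) (hC : 0 ≤ C)
    (hb : ∀ r N, r < N → l ≤ r → r + l ≤ N → ‖g N r - c‖ ≤ C * (ρ ^ (r - l) + ρ ^ (N - r - l)))
    (hp : ∀ r, Tendsto (fun N => g N r) atTop (𝓝 (Gp r)))
    (hm : ∀ r, Tendsto (fun N => g N (N - (r + 1))) atTop (𝓝 (Gm r))) :
    ∃ C', Clusters g c Gp Gm C' ρ := by
  have hinv : ∀ n, ρ ^ (n - l) ≤ (ρ ^ l)⁻¹ * ρ ^ n := fun n => by
    rw [inv_mul_eq_div, le_div_iff₀ (by positivity), ← pow_add]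
    exact pow_le_pow_of_le_one hρ0.le hρ1.le (by omega)
  have hone : ∀ n, n ≤ l → 1 ≤ (ρ ^ l)⁻¹ * ρ ^ n := fun n hn => by
    simpa [Nat.sub_eq_zero_of_le hn] using hinv n
  have hsum : ∀ G : ℕ → ℂ, ∀ r < l, ‖G r - c‖ ≤ ∑ r ∈ Finset.range l, ‖G r - c‖ := fun G r hr =>
    Finset.single_le_sum (f := fun r => ‖G r - c‖) (fun _ _ => norm_nonneg _)
      (Finset.mem_range.2 hr)
  set D := C + (∑ r ∈ Finset.range l, ‖Gp r - c‖ + 1) + (∑ r ∈ Finset.range l, ‖Gm r - c‖ + 1)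
    with hD
  have hp0 : 0 ≤ ∑ r ∈ Finset.range l, ‖Gp r - c‖ := Finset.sum_nonneg fun _ _ => norm_nonneg _
  have hm0 : 0 ≤ ∑ r ∈ Finset.range l, ‖Gm r - c‖ := Finset.sum_nonneg fun _ _ => norm_nonneg _
  have hD0 : 0 ≤ D := by positivity
  refine ⟨D * (ρ ^ l)⁻¹, hρ0.le, hρ1, by positivity, ?_, hp, hm⟩
  have hp1 : ∀ᶠ N in atTop, ∀ r ∈ Finset.range l, ‖g N r - c‖ < ‖Gp r - c‖ + 1 :=
    (Filter.eventually_all_finset _).2 fun r _ =>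
      ((hp r).sub_const c).norm.eventually_lt_const (lt_add_one _)
  have hm1 : ∀ᶠ N in atTop, ∀ r ∈ Finset.range l, ‖g N (N - (r + 1)) - c‖ < ‖Gm r - c‖ + 1 :=
    (Filter.eventually_all_finset _).2 fun r _ =>
      ((hm r).sub_const c).norm.eventually_lt_const (lt_add_one _)
  filter_upwards [hp1, hm1] with N hp1 hm1 r hr
  have hsplit : D * (ρ ^ l)⁻¹ * (ρ ^ r + ρ ^ (N - r)) =
      D * ((ρ ^ l)⁻¹ * ρ ^ r + (ρ ^ l)⁻¹ * ρ ^ (N - r)) := by ring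
  rw [hsplit]
  have n1 : 0 ≤ (ρ ^ l)⁻¹ * ρ ^ r := by positivity
  have n2 : 0 ≤ (ρ ^ l)⁻¹ * ρ ^ (N - r) := by positivity
  by_cases h1 : r < l
  · calc _ ≤ D * 1 := by linarith [hp1 r (Finset.mem_range.2 h1), hsum Gp r h1]
      _ ≤ _ := by
        gcongr
        linarith [hone r h1.le]
  by_cases h2 : N - r ≤ l
  · obtain ⟨b, hb⟩ : ∃ b, N - r = b + 1 := ⟨N - r - 1, by omega⟩
    have hr' : N - (b + 1) = r := by omega
    have h3 := hm1 b (Finset.mem_range.2 (by omega))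
    rw [hr'] at h3
    calc _ ≤ D * 1 := by linarith [hsum Gm b (by omega)]
      _ ≤ _ := by
        gcongr
        linarith [hone (N - r) h2]
  · calc _ ≤ C * (ρ ^ (r - l) + ρ ^ (N - r - l)) := hb r N hr (by omega) (by omega)
      _ ≤ D * _ := by
        gcongr
        · linarith
        · exact hinv r
        · exact hinv (N - r)

end ThermodynamicLimit

variable {χ d : ℕ}

/-! ### Local operators acting on the matrix-product state. -/

section DressedStates

/-- The matrix-product state with the operator `Z` acting on the window starting at site `i`. -/
def dressedVec {l : ℕ} (N : ℕ) (A : Fin d → Matrix (Fin χ) (Fin χ) ℂ)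
    (Z : Matrix (Fin l → Fin d) (Fin l → Fin d) ℂ) (i : Fin N) : (Fin N → Fin d) → ℂ :=
  (localOp (fun a : Fin l => siteAdd i a) Z).mulVec (mpsVec N A)

variable {l : ℕ} (A : Fin d → Matrix (Fin χ) (Fin χ) ℂ)
  (X Y Z : Matrix (Fin l → Fin d) (Fin l → Fin d) ℂ)

theorem mpsVec_shift {N : ℕ} (n : ℕ) (s : Fin N → Fin d) :
    mpsVec N A (fun x => s (siteAdd x n)) = mpsVec N A s :=
  trace_prod_ofFn_siteAdd (fun x => A (s x)) n

theorem dressedVec_isCovariant {N : ℕ} (hl : l ≤ N) : IsCovariant (dressedVec N A Z) := by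
  intro i n s
  rw [dressedVec, dressedVec, localOp_mulVec (window_injective hl _),
    localOp_mulVec (window_injective hl _)]
  refine Finset.sum_congr rfl fun t _ => ?_
  have hw : (fun a : Fin l => siteAdd (siteAdd i n) a) = shift N n ∘ fun a : Fin l => siteAdd i a :=
    funext fun a => siteAdd_right_comm _ _ _
  congr 1
  · rw [hw]
    rfl
  · rw [← mpsVec_shift A n (Function.extend _ t s), hw]
    congr 1
    have := (window_injective hl i).extend_comp (shift N n).injective t s
    rw [this]
    funext x
    exact (shift N n).injective.extend_apply _ _ x

/-- Both insertions lie in the first `n` sites, so each of the other `b` sites contributes one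
factor of the transfer matrix. -/
theorem dotProduct_localOp_castAdd {n : ℕ} {f g : Fin l → Fin n} (hf : f.Injective)
    (hg : g.Injective) (b : ℕ) :
    star ((localOp (Fin.castAdd b ∘ f) X).mulVec (mpsVec (n + b) A)) ⬝ᵥ
        (localOp (Fin.castAdd b ∘ g) Y).mulVec (mpsVec (n + b) A) =
      (mixedTransfer (dressedWord A f X) (dressedWord A g Y) * transfer A A ^ b).trace := by
  rw [localOp_mulVec_mpsVec A ((Fin.castAdd_injective n b).comp hf),
    localOp_mulVec_mpsVec A ((Fin.castAdd_injective n b).comp hg), ← trace_mixedTransfer,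
    mixedTransfer_append (dressedWord_castAdd A hf X b) (dressedWord_castAdd A hg Y b),
    mixedTransfer_word]

theorem dotProduct_mpsVec_localOp_castAdd {n : ℕ} {g : Fin l → Fin n} (hg : g.Injective) (b : ℕ) :
    star (mpsVec (n + b) A) ⬝ᵥ (localOp (Fin.castAdd b ∘ g) Y).mulVec (mpsVec (n + b) A) =
      (mixedTransfer (word A) (dressedWord A g Y) * transfer A A ^ b).trace := by
  rw [localOp_mulVec_mpsVec A ((Fin.castAdd_injective n b).comp hg)]
  change star (fun s => (word A s).trace) ⬝ᵥ _ = _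
  rw [← trace_mixedTransfer, mixedTransfer_append (word_append A) (dressedWord_castAdd A hg Y b), mixedTransfer_word]

theorem dressedVec_eq_natAdd {r b : ℕ} (i : Fin (r + l + b)) (hi : i.val = r) :
    dressedVec (r + l + b) A Z i =
      (localOp (Fin.castAdd b ∘ Fin.natAdd r) Z).mulVec (mpsVec (r + l + b) A) := by
  rw [dressedVec]
  congr 2
  funext a
  ext
  simp only [siteAdd, hi, Function.comp_apply, Fin.val_castAdd, Fin.val_natAdd]
  exact Nat.mod_eq_of_lt (by omega)

theorem dressedVec_eq_castLE {n b : ℕ} (hl : l ≤ n) (i : Fin (n + b)) (hi : i.val = 0) :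
    dressedVec (n + b) A Z i =
      (localOp (Fin.castAdd b ∘ Fin.castLE hl) Z).mulVec (mpsVec (n + b) A) := by
  rw [dressedVec]
  congr 2
  funext a
  ext
  simp only [siteAdd, hi, Function.comp_apply, Fin.val_castAdd, Fin.val_castLE, zero_add]
  exact Nat.mod_eq_of_lt (by omega)

theorem dressedWord_id : dressedWord A (id : Fin l → Fin l) Z = fun u => ∑ t, Z u t • word A t := by
  funext u
  simp [dressedWord, Function.extend_id]

/-- At fixed distance both windows lie in one block, and the rest of the ring is a power of the
transfer matrix, which gives the limits. For disjoint windows the overlap is `tr (S E^a T E^b)`, so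
`c` is a product of two one-point functions. Its second factor is the limit of `⟨A|Y|A⟩`. -/
theorem dressed_clusters (R : DominantResolution (transfer A A)) :
    ∃ (c : ℂ) (Gp Gm : ℕ → ℂ) (C ρ : ℝ),
      Clusters (fun N => corr (dressedVec N A X) (dressedVec N A Y)) c Gp Gm C ρ ∧
      ((∀ᶠ N in atTop, ∀ i, star (mpsVec N A) ⬝ᵥ dressedVec N A Y i = 0) → c = 0) := by
  obtain ⟨ρ, hρ0, hρ1, hdec⟩ := R.exists_norm_trace_sub_le
  set S := mixedTransfer (dressedWord A (id : Fin l → Fin l) X) (word A) with hS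
  set T := mixedTransfer (word A) (dressedWord A (id : Fin l → Fin l) Y) with hT
  obtain ⟨C, hC, hST⟩ := hdec S T
  have hright : ∀ r, ∃ G, Tendsto (fun N => corr (dressedVec N A X) (dressedVec N A Y) r) atTop
      (𝓝 G) := fun r => by
    refine ⟨_, ((R.tendsto_trace_mul_pow (mixedTransfer
      (dressedWord A (Fin.castLE (Nat.le_add_left l r)) X)
      (dressedWord A (Fin.natAdd r) Y))).comp (tendsto_sub_atTop_nat (r + l))).congr' ?_⟩
    filter_upwards [eventually_gt_atTop (r + l)] with N hN
    obtain ⟨b, rfl⟩ := Nat.exists_eq_add_of_lt hN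
    rw [add_assoc (r + l) b 1] at *
    rw [corr, dif_pos (by omega), dressedVec_eq_natAdd A Y ⟨r, _⟩ rfl,
      dressedVec_eq_castLE A X (Nat.le_add_left l r) ⟨0, _⟩ rfl,
      dotProduct_localOp_castAdd _ _ _ (Fin.castLE_injective _) (Fin.natAdd_injective _ _)]
    simp
  have hleft : ∀ r, ∃ G, Tendsto (fun N => corr (dressedVec N A X) (dressedVec N A Y) (N - (r + 1)))
      atTop (𝓝 G) := fun r => by
    refine ⟨_, ((R.tendsto_trace_mul_pow (mixedTransfer (dressedWord A (Fin.natAdd (r + 1)) X)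
      (dressedWord A (Fin.castLE (Nat.le_add_left l (r + 1))) Y))).comp
      (tendsto_sub_atTop_nat (r + 1 + l))).congr' ?_⟩
    filter_upwards [eventually_gt_atTop (r + 1 + l)] with N hN
    obtain ⟨b, rfl⟩ := Nat.exists_eq_add_of_lt hN
    rw [add_assoc (r + 1 + l) b 1] at *
    rw [(dressedVec_isCovariant A X (by omega)).corr_sub (dressedVec_isCovariant A Y (by omega))
      (by omega), dressedVec_eq_natAdd A X ⟨r + 1, _⟩ rfl,
      dressedVec_eq_castLE A Y (Nat.le_add_left l (r + 1)) ⟨0, _⟩ rfl,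
      dotProduct_localOp_castAdd _ _ _ (Fin.natAdd_injective _ _) (Fin.castLE_injective _)]
    simp
  choose Gp hp using hright
  choose Gm hm using hleft
  obtain ⟨C', hcl⟩ := exists_clusters (l := l) (c := R.contract R.top S R.top *
    R.contract R.top T R.top) (g := fun N => corr (dressedVec N A X) (dressedVec N A Y))
    hρ0 hρ1 hC (fun r N hlt hr hN => by
      obtain ⟨a, rfl⟩ := Nat.exists_eq_add_of_le hr
      obtain ⟨b, rfl⟩ := Nat.exists_eq_add_of_le hN
      have e1 : l + a - l = a := by omega
      have e2 : l + a + l + b - (l + a) - l = b := by omega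
      rw [e1, e2]
      refine le_trans (le_of_eq ?_) (hST a b)
      rw [corr, dif_pos hlt, dressedVec_eq_natAdd (r := l + a) A Y ⟨l + a, hlt⟩ rfl,
        dressedVec_eq_castLE A X (Nat.le_add_left l (l + a)) ⟨0, _⟩ rfl,
        dotProduct_localOp_castAdd _ _ _ (Fin.castLE_injective _) (Fin.natAdd_injective _ _)]
      congr 3
      have h1 : (Fin.castLE (Nat.le_add_left l (l + a)) : Fin l → Fin (l + a + l)) =
        Fin.castAdd l ∘ Fin.castAdd a ∘ id := rfl
      have h2 : (Fin.natAdd (l + a) : Fin l → Fin (l + a + l)) = Fin.natAdd (l + a) ∘ id := rfl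
      rw [h1, h2, mixedTransfer_append
        (dressedWord_castAdd A ((Fin.castAdd_injective l a).comp Function.injective_id) X l)
        (dressedWord_natAdd A Function.injective_id Y (l + a)),
        mixedTransfer_append (dressedWord_castAdd A Function.injective_id X a) (word_append A),
        mixedTransfer_word]) hp hm
  refine ⟨_, Gp, Gm, C', ρ, hcl, fun h0 => ?_⟩
  suffices R.contract R.top T R.top = 0 by rw [this, mul_zero]
  refine tendsto_nhds_unique ((R.tendsto_trace_mul_pow T).comp (tendsto_sub_atTop_nat l))
    (tendsto_const_nhds.congr' ?_)
  filter_upwards [h0, eventually_gt_atTop l] with N h0 hN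
  obtain ⟨b, rfl⟩ := Nat.exists_eq_add_of_lt hN
  rw [add_assoc l b 1] at *
  rw [← h0 ⟨0, by omega⟩, dressedVec_eq_castLE A Y le_rfl _ rfl,
    dotProduct_mpsVec_localOp_castAdd _ _ (Fin.castLE_injective _)]
  simp
  rfl

end DressedStates

/-! ### States with the tensor replaced at one site. -/

section SiteStates

/-- The matrix-product state with tensor `A` on all sites but `j`, where the tensor is `B`. -/
def siteVec (N : ℕ) (A B : Fin d → Matrix (Fin χ) (Fin χ) ℂ) (j : Fin N) : (Fin N → Fin d) → ℂ :=
  fun s => (siteWord (fun i => if i = j then B else A) s).trace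

variable (A B : Fin d → Matrix (Fin χ) (Fin χ) ℂ)

theorem siteVec_isCovariant (N : ℕ) : IsCovariant (siteVec N A B) := by
  intro j n s
  rw [siteVec, siteWord, ← trace_prod_ofFn_siteAdd _ n]
  have : ∀ x, siteAdd x n = siteAdd j n ↔ x = j := fun x => (siteAdd_injective n).eq_iff
  simp only [siteVec, siteWord, this]

theorem siteWord_append_left {n k : ℕ} (j : Fin (n + k)) (hj : j.val < n) (u : Fin n → Fin d)
    (v : Fin k → Fin d) :
    siteWord (fun i => if i = j then B else A) (Fin.append u v) =
      siteWord (fun i => if i = ⟨j.val, hj⟩ then B else A) u * word A v := by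
  have h1 : ∀ i : Fin n, Fin.castAdd k i = j ↔ i = ⟨j.val, hj⟩ := fun i => by simp [Fin.ext_iff]
  have h2 : ∀ i : Fin k, Fin.natAdd n i ≠ j := fun i h => by
    have := congrArg Fin.val h
    rw [Fin.val_natAdd] at this
    omega
  rw [siteWord_append, word]
  simp only [h1, h2, if_false]

theorem siteWord_append_right {n k : ℕ} (j : Fin (n + k)) (i₀ : Fin k) (hj : j.val = n + i₀.val)
    (u : Fin n → Fin d) (v : Fin k → Fin d) :
    siteWord (fun i => if i = j then B else A) (Fin.append u v) =
      word A u * siteWord (fun i => if i = i₀ then B else A) v := by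
  have h1 : ∀ i : Fin n, Fin.castAdd k i ≠ j := fun i h => by
    have := congrArg Fin.val h
    rw [Fin.val_castAdd] at this
    omega
  have h2 : ∀ i : Fin k, Fin.natAdd n i = j ↔ i = i₀ := fun i => by simp [Fin.ext_iff, hj]
  rw [siteWord_append, word]
  simp only [h1, h2, if_false]

theorem siteVec_dotProduct_self (b : ℕ) (i : Fin (1 + b)) (hi : i.val = 0) :
    star (siteVec (1 + b) A B i) ⬝ᵥ siteVec (1 + b) A B i =
      (transfer B B * transfer A A ^ b).trace := by
  have h := siteWord_append_left A B i (by omega)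
  change star (fun s => (siteWord (fun x => if x = i then B else A) s).trace) ⬝ᵥ
    (fun s => (siteWord (fun x => if x = i then B else A) s).trace) = _
  rw [← trace_mixedTransfer, mixedTransfer_append h h, mixedTransfer_siteWord_one,
    mixedTransfer_word]
  simp [hi]

theorem mixedTransfer_siteWord_zero_right (a b : ℕ) (i j : Fin (1 + a + 1 + b)) (hi : i.val = 0)
    (hj : j.val = 1 + a) (A₁ B₁ A₂ B₂ : Fin d → Matrix (Fin χ) (Fin χ) ℂ) :
    mixedTransfer (siteWord fun x => if x = i then B₁ else A₁)
      (siteWord fun x => if x = j then B₂ else A₂) =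
      transfer B₁ A₂ * mixedTransfer (word A₁ : (Fin a → Fin d) → _) (word A₂) * transfer A₁ B₂ *
        mixedTransfer (word A₁ : (Fin b → Fin d) → _) (word A₂) := by
  rw [mixedTransfer_append (siteWord_append_left A₁ B₁ i (by omega))
    (siteWord_append_left A₂ B₂ j (by omega)),
    mixedTransfer_append (siteWord_append_left A₁ B₁ ⟨i.val, by omega⟩ (by simp only; omega))
    (siteWord_append_right A₂ B₂ ⟨j.val, by omega⟩ 0 (by simp [hj])),
    mixedTransfer_append (siteWord_append_left A₁ B₁ ⟨i.val, by omega⟩ (by simp only; omega))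
    (word_append A₂)]
  have h1 : mixedTransfer (siteWord fun x : Fin 1 => if x = ⟨i.val, by omega⟩ then B₁ else A₁)
      (word A₂) = transfer B₁ A₂ := (mixedTransfer_siteWord_one _ _).trans (by simp [hi])
  have h2 : mixedTransfer (word A₁) (siteWord fun x : Fin 1 => if x = 0 then B₂ else A₂) =
      transfer A₁ B₂ := (mixedTransfer_siteWord_one _ _).trans (by simp)
  rw [h1, h2]

theorem siteVec_dotProduct (a b : ℕ) (i j : Fin (1 + a + 1 + b)) (hi : i.val = 0)
    (hj : j.val = 1 + a) :
    star (siteVec (1 + a + 1 + b) A B i) ⬝ᵥ siteVec (1 + a + 1 + b) A B j =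
      (transfer B A * transfer A A ^ a * transfer A B * transfer A A ^ b).trace := by
  change star (fun s => (siteWord (fun x => if x = i then B else A) s).trace) ⬝ᵥ
    (fun s => (siteWord (fun x => if x = j then B else A) s).trace) = _
  rw [← trace_mixedTransfer, mixedTransfer_siteWord_zero_right a b i j hi hj, mixedTransfer_word,
    mixedTransfer_word]

end SiteStates

/-! ### The norm per site as a tensor contraction. -/

section NormDensity

variable {χ d : ℕ} (A B : Fin d → Matrix (Fin χ) (Fin χ) ℂ)

theorem corr_siteVec_zero {N : ℕ} (hN : 0 < N) :
    corr (siteVec N A B) (siteVec N A B) 0 = (transfer B B * transfer A A ^ (N - 1)).trace := by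
  obtain ⟨b, rfl⟩ := Nat.exists_eq_add_of_le hN
  rw [corr, dif_pos hN]
  refine (siteVec_dotProduct_self A B b _ rfl).trans ?_
  rw [show (0 : ℕ).succ + b - 1 = b by omega]

theorem corr_siteVec {N r : ℕ} (hr : 1 ≤ r) (hN : r < N) :
    corr (siteVec N A B) (siteVec N A B) r =
      (transfer B A * transfer A A ^ (r - 1) * transfer A B * transfer A A ^ (N - r - 1)).trace := by
  obtain ⟨a, rfl⟩ := Nat.exists_eq_add_of_le hr
  obtain ⟨b, rfl⟩ := Nat.exists_eq_add_of_le (Nat.succ_le_of_lt hN)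
  rw [corr, dif_pos hN]
  refine (siteVec_dotProduct A B a b _ _ rfl rfl).trans ?_
  rw [show 1 + a - 1 = a by omega, show (1 + a).succ + b - (1 + a) - 1 = b by omega]

variable {A} (R : DominantResolution (transfer A A))

/-- The two-point function of the tensor `B` to the right, in the thermodynamic limit. -/
def rightCorr : ℕ → ℂ
  | 0 => R.contract R.top (transfer B B) R.top
  | r + 1 => R.contract R.top (transfer B A * transfer A A ^ r * transfer A B) R.top

/-- The two-point function of the tensor `B` to the left, in the thermodynamic limit. -/
def leftCorr (r : ℕ) : ℂ :=
  R.contract R.top (transfer A B * transfer A A ^ r * transfer B A) R.top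

/-- The disconnected part of the two-point function of the tensor `B`. -/
def disconnectedCorr : ℂ :=
  R.contract R.top (transfer B A) R.top * R.contract R.top (transfer A B) R.top

theorem site_clusters : ∃ C ρ, Clusters (fun N => corr (siteVec N A B) (siteVec N A B))
    (disconnectedCorr B R) (rightCorr B R) (leftCorr B R) C ρ := by
  obtain ⟨ρ, hρ0, hρ1, hdec⟩ := R.exists_norm_trace_sub_le
  obtain ⟨C, hC, hST⟩ := hdec (transfer B A) (transfer A B)
  obtain ⟨C', h⟩ := exists_clusters (l := 1) (c := disconnectedCorr B R) (Gp := rightCorr B R)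
    (Gm := leftCorr B R) (g := fun N => corr (siteVec N A B) (siteVec N A B)) hρ0 hρ1 hC
    (fun r N hlt hr hN => by
      simp only [corr_siteVec A B hr hlt]
      exact hST _ _)
    (fun r => by
      cases r with
      | zero =>
        refine ((R.tendsto_trace_mul_pow (transfer B B)).comp (tendsto_sub_atTop_nat 1)).congr' ?_
        filter_upwards [eventually_gt_atTop 0] with N hN
        rw [corr_siteVec_zero A B hN]
        rfl
      | succ r =>
        refine ((R.tendsto_trace_mul_pow (transfer B A * transfer A A ^ r * transfer A B)).comp
          (tendsto_sub_atTop_nat (r + 2))).congr' ?_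
        filter_upwards [eventually_gt_atTop (r + 1)] with N hN
        rw [corr_siteVec A B (by omega) hN]
        rfl)
    (fun r => by
      refine ((R.tendsto_trace_mul_pow (transfer A B * transfer A A ^ r * transfer B A)).comp
        (tendsto_sub_atTop_nat (r + 2))).congr' ?_
      filter_upwards [eventually_gt_atTop (r + 1)] with N hN
      -- Cyclicity of the trace puts the long arc last.
      rw [corr_siteVec A B (by omega) (by omega), mul_assoc (transfer B A * _),
        Matrix.trace_mul_comm, show N - (N - (r + 1)) - 1 = r by omega,
        show N - (r + 1) - 1 = N - (r + 2) by omega]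
      simp only [Function.comp_apply, mul_assoc])
  exact ⟨C', ρ, h⟩

/-- The dominant eigenvalue is `1`, so its term in the spectral sum is the disconnected part for
every `r`. -/
theorem contract_pow_sub (S T : Matrix (Fin χ × Fin χ) (Fin χ × Fin χ) ℂ) (r : ℕ) :
    R.contract R.top (S * transfer A A ^ r * T) R.top -
        R.contract R.top S R.top * R.contract R.top T R.top =
      ∑ n ∈ Finset.univ.erase R.top,
        R.ev n ^ r * (R.contract R.top S n * R.contract n T R.top) := by
  rw [R.pow_eq_spectralFun, R.contract_mul_spectralFun_mul,
    ← Finset.add_sum_erase _ _ (Finset.mem_univ R.top)]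
  simp [R.ev_top]

/-- For each subdominant eigenvalue this is the geometric series `∑ w (w λ)^r = 1 / (w⁻¹ - λ)`. -/
theorem hasSum_contract_pow (S T : Matrix (Fin χ × Fin χ) (Fin χ × Fin χ) ℂ) {w : ℂ}
    (hw : ‖w‖ = 1) :
    HasSum (fun r : ℕ => w ^ (r + 1) * (R.contract R.top (S * transfer A A ^ r * T) R.top -
        R.contract R.top S R.top * R.contract R.top T R.top))
      (∑ n ∈ Finset.univ.erase R.top,
        R.contract R.top S n * R.contract n T R.top / (w⁻¹ - R.ev n)) := by
  have hw0 : w ≠ 0 := norm_ne_zero_iff.1 (by rw [hw]; exact one_ne_zero)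
  simp only [contract_pow_sub, Finset.mul_sum]
  refine hasSum_sum fun n hn => ?_
  have hlt : ‖w * R.ev n‖ < 1 := by
    rw [norm_mul, hw, one_mul]
    exact R.norm_ev_lt_one n (Finset.ne_of_mem_erase hn)
  have h := ((hasSum_geometric_of_norm_lt_one hlt).mul_left w).mul_right
    (R.contract R.top S n * R.contract n T R.top)
  have e : w * (1 - w * R.ev n)⁻¹ = (w⁻¹ - R.ev n)⁻¹ := by
    rw [show w⁻¹ - R.ev n = w⁻¹ * (1 - w * R.ev n) by field_simp, mul_inv, inv_inv]
  rw [e, inv_mul_eq_div] at h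
  refine h.congr_fun fun r => ?_
  ring

theorem ringSum_eq_normDensitySq (k : ℝ) :
    ringSum (rightCorr B R) (leftCorr B R) (disconnectedCorr B R) k = normDensitySq A B R k := by
  have h1 := hasSum_contract_pow R (transfer B A) (transfer A B) (norm_exp_I_mul k)
  have h2 := hasSum_contract_pow R (transfer A B) (transfer B A) (norm_exp_neg_I_mul k)
  rw [← Complex.exp_neg] at h1 h2
  rw [neg_neg] at h2
  -- The index shift adds the coincident-site term `r = 0`, which supplies the `(L|T_{BB}|R)` term
  -- and the subtracted product in `normDensitySq`.
  have hR : HasSum (fun r : ℕ => Complex.exp (Complex.I * k) ^ r *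
      (rightCorr B R r - disconnectedCorr B R)) _ := (hasSum_nat_add_iff 1).1 h1
  have hc : disconnectedCorr B R =
      R.contract R.top (transfer A B) R.top * R.contract R.top (transfer B A) R.top := mul_comm _ _
  rw [← hc] at h2
  rw [ringSum, hR.tsum_eq]
  simp only [leftCorr]
  rw [h2.tsum_eq]
  rw [normDensitySq, Finset.sum_add_distrib, Finset.sum_range_one, pow_zero, one_mul, rightCorr,
    disconnectedCorr]
  ring

end NormDensity

/-! ### Matrix-product operators applied to product states. -/

section ProductStates

variable {χ d p : ℕ}

theorem sum_prod_smul_siteWord {N : ℕ} (W : Fin d → Fin p → Matrix (Fin χ) (Fin χ) ℂ)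
    (φ : Fin N → Fin p → ℂ) (l : Fin N → Fin d) :
    ∑ s : Fin N → Fin p, (∏ i, φ i (s i)) • (List.ofFn fun i => W (l i) (s i)).prod =
      siteWord (fun i => mpsTensor W (φ i)) l := by
  induction N with
  | zero => simp [siteWord]
  | succ n ih =>
    rw [← (Fin.consEquiv fun _ => Fin p).sum_comp, Fintype.sum_prod_type, siteWord, List.ofFn_succ,
      List.prod_cons]
    change _ = _ * siteWord (fun i : Fin n => mpsTensor W (φ i.succ)) fun i => l i.succ
    rw [← ih, mpsTensor, Finset.sum_mul_sum]
    refine Finset.sum_congr rfl fun x _ => Finset.sum_congr rfl fun s _ => ?_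
    simp [Fin.consEquiv, Fin.prod_univ_succ, List.ofFn_succ, smul_smul, mul_comm]

theorem mpo_mulVec_prod (N : ℕ) (W : Fin d → Fin p → Matrix (Fin χ) (Fin χ) ℂ)
    (φ : Fin N → Fin p → ℂ) :
    (mpo N W).mulVec (fun s => ∏ i, φ i (s i)) =
      fun l => (siteWord (fun i => mpsTensor W (φ i)) l).trace := by
  funext l
  rw [← sum_prod_smul_siteWord, Matrix.trace_sum, Matrix.mulVec, dotProduct]
  simp [mpo, mul_comm]

theorem mpo_mulVec_productState (N : ℕ) (W : Fin d → Fin p → Matrix (Fin χ) (Fin χ) ℂ)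
    (ψ : Fin p → ℂ) : (mpo N W).mulVec (productState N ψ) = mpsVec N (mpsTensor W ψ) :=
  mpo_mulVec_prod N W fun _ => ψ

theorem onsiteAction_mulVec_productState (N : ℕ) (M : Matrix (Fin p) (Fin p) ℂ) (ψ : Fin p → ℂ) :
    (onsiteAction N M).mulVec (productState N ψ) = productState N (M.mulVec ψ) := by
  funext s
  simp only [Matrix.mulVec, dotProduct, productState, onsiteAction, Matrix.of_apply,
    ← Finset.prod_mul_distrib]
  exact (Finset.prod_univ_sum (fun _ => Finset.univ) fun i x => M (s i) x * ψ x).symm ▸ by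
    rw [Fintype.piFinset_univ]

theorem siteOp_mulVec_productState (N : ℕ) (q : Matrix (Fin p) (Fin p) ℂ) (ψ : Fin p → ℂ)
    (j : Fin N) :
    (siteOp N q j).mulVec (productState N ψ) =
      fun s => ∏ i, (if i = j then q.mulVec ψ else ψ) (s i) := by
  funext s
  have h1 : (siteOp N q j).mulVec (productState N ψ) s =
      ∑ x, q (s j) x * (ψ x * ∏ i ∈ Finset.univ.erase j, ψ (s i)) := by
    rw [Matrix.mulVec, dotProduct]
    refine (Fintype.sum_of_injective (fun x => Function.update s j x)
      (Function.update_injective s j) _ _ ?_ ?_).symm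
    · intro t ht
      rw [siteOp, Matrix.of_apply, if_neg, zero_mul]
      intro hst
      refine ht ⟨t j, funext fun i => ?_⟩
      by_cases hi : i = j
      · subst hi
        simp
      · simp [hi, hst i hi]
    · intro x
      rw [siteOp, Matrix.of_apply, if_pos (fun i hi => by simp [hi]), productState,
        ← Finset.mul_prod_erase _ _ (Finset.mem_univ j)]
      simp only [Function.update_self]
      congr 2
      exact Finset.prod_congr rfl fun i hi => by simp [Finset.ne_of_mem_erase hi]
  rw [h1, ← Finset.mul_prod_erase _ _ (Finset.mem_univ j), if_pos rfl, Matrix.mulVec, dotProduct,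
    Finset.sum_mul]
  refine Finset.sum_congr rfl fun x _ => ?_
  rw [mul_assoc]
  congr 2
  exact Finset.prod_congr rfl fun i hi => by rw [if_neg (Finset.ne_of_mem_erase hi)]

theorem mpo_mulVec_siteOp (N : ℕ) (W : Fin d → Fin p → Matrix (Fin χ) (Fin χ) ℂ)
    (q : Matrix (Fin p) (Fin p) ℂ) (ψ : Fin p → ℂ) (j : Fin N) :
    (mpo N W).mulVec ((siteOp N q j).mulVec (productState N ψ)) =
      siteVec N (mpsTensor W ψ) (mpsTensor W (q.mulVec ψ)) j := by
  rw [siteOp_mulVec_productState, mpo_mulVec_prod]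
  funext s
  rw [siteVec]
  congr 2
  funext i
  split_ifs <;> rfl

end ProductStates

/-! ### Tangent vectors of the orbit lie in the deformed space. -/

section DeformedSpace

variable {G : Type*} [Group G] {χ d p : ℕ} (N : ℕ) (W : Fin d → Fin p → Matrix (Fin χ) (Fin χ) ℂ)
  (U : G →* Matrix.unitaryGroup (Fin p) ℂ) (ψ : Fin p → ℂ)

theorem mpo_productState_mem_deformedSpace (g : G) :
    (mpo N W).mulVec (productState N ((U g : Matrix (Fin p) (Fin p) ℂ).mulVec ψ)) ∈
      deformedSpace N W U ψ := by
  rw [← onsiteAction_mulVec_productState]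
  exact Submodule.subset_span ⟨g, rfl⟩

theorem mpsVec_mem_deformedSpace : mpsVec N (mpsTensor W ψ) ∈ deformedSpace N W U ψ := by
  have h := mpo_productState_mem_deformedSpace N W U ψ 1
  rwa [map_one, OneMemClass.coe_one, Matrix.one_mulVec, mpo_mulVec_productState] at h

theorem siteOp_add (q q' : Matrix (Fin p) (Fin p) ℂ) (j : Fin N) :
    siteOp N (q + q') j = siteOp N q j + siteOp N q' j := by
  ext s t
  simp only [siteOp, Matrix.of_apply, Matrix.add_apply]
  split_ifs <;> simp

theorem siteOp_smul (a : ℂ) (q : Matrix (Fin p) (Fin p) ℂ) (j : Fin N) :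
    siteOp N (a • q) j = a • siteOp N q j := by
  ext s t
  simp only [siteOp, Matrix.of_apply, Matrix.smul_apply]
  split_ifs <;> simp

/-- Difference quotients stay in `V`, which is closed because it is finite-dimensional. -/
theorem HasDerivAt.mem_of_forall_mem {ι : Type*} [Fintype ι] {V : Submodule ℂ (ι → ℂ)}
    {c : ℝ → ι → ℂ} {c' : ι → ℂ} {x : ℝ} (hc : HasDerivAt c c' x) (hV : ∀ θ, c θ ∈ V) : c' ∈ V := by
  have hcl : IsClosed (V : Set (ι → ℂ)) := V.closed_of_finiteDimensional
  refine hcl.mem_of_tendsto hc.tendsto_slope (Eventually.of_forall fun θ => ?_)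
  rw [slope_def_module]
  have : (θ - x)⁻¹ • (c θ - c x) = (((θ - x)⁻¹ : ℝ) : ℂ) • (c θ - c x) := by
    ext i
    simp
  rw [this]
  exact V.smul_mem _ (V.sub_mem (hV θ) (hV x))

section

attribute [local instance] Matrix.linftyOpNormedRing Matrix.linftyOpNormedAlgebra

theorem hasDerivAt_exp_I_smul (Q : Matrix (Fin p) (Fin p) ℂ) (i j : Fin p) :
    HasDerivAt (fun θ : ℝ => NormedSpace.exp ((Complex.I * θ) • Q) i j) (Complex.I * Q i j) 0 := by
  have h := hasDerivAt_exp_smul_const (𝕂 := ℝ) (Complex.I • Q) 0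
  have h1 : HasDerivAt (fun θ : ℝ => NormedSpace.exp (θ • (Complex.I • Q)) i j)
      ((NormedSpace.exp ((0 : ℝ) • (Complex.I • Q)) * (Complex.I • Q)) i j) 0 :=
    hasDerivAt_pi.1 (hasDerivAt_pi.1 h i) j
  rw [zero_smul, NormedSpace.exp_zero, one_mul] at h1
  refine h1.congr_of_eventuallyEq (Eventually.of_forall fun θ => ?_)
  have : θ • (Complex.I • Q) = (Complex.I * θ) • Q := by
    ext a b
    simp [mul_assoc, mul_left_comm]
  simp only [this]

end

/-- For a generator `Q`, the Leibniz rule gives `i ∑ j, Ŵ Q_j ψ^{⊗N}` as the derivative at `θ = 0`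
of the curve `Ŵ (exp (iθQ))^{⊗N} ψ^{⊗N}` in the deformed space. Complex combinations follow by
linearity in `q`. -/
theorem sum_siteOp_mem_deformedSpace {q : Matrix (Fin p) (Fin p) ℂ}
    (hq : q ∈ complexLieAlgebra U) :
    ∑ j, (mpo N W).mulVec ((siteOp N q j).mulVec (productState N ψ)) ∈ deformedSpace N W U ψ := by
  induction hq using Submodule.span_induction with
  | mem Q hQ =>
    obtain ⟨-, hQ⟩ := hQ
    have hφ : ∀ i, HasDerivAt (fun θ : ℝ => (NormedSpace.exp ((Complex.I * θ) • Q)).mulVec ψ i)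
        (Complex.I * Q.mulVec ψ i) 0 := fun i => by
      have := HasDerivAt.fun_sum (u := Finset.univ)
        fun j _ => (hasDerivAt_exp_I_smul Q i j).mul_const (ψ j)
      refine this.congr_deriv ?_
      rw [Matrix.mulVec, dotProduct, Finset.mul_sum]
      exact Finset.sum_congr rfl fun _ _ => mul_assoc _ _ _
    have h0 : ∀ i, (NormedSpace.exp ((Complex.I * (0 : ℝ)) • Q)).mulVec ψ i = ψ i := fun i => by
      simp
    have hprod : ∀ s, HasDerivAt (fun θ : ℝ =>
        productState N ((NormedSpace.exp ((Complex.I * θ) • Q)).mulVec ψ) s)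
        (∑ j, Complex.I * (siteOp N Q j).mulVec (productState N ψ) s) 0 := fun s => by
      have := HasDerivAt.fun_finsetProd (u := Finset.univ) fun i _ => hφ (s i)
      refine this.congr_deriv ?_
      refine Finset.sum_congr rfl fun j _ => ?_
      rw [siteOp_mulVec_productState]
      dsimp only
      rw [← Finset.mul_prod_erase Finset.univ (fun i => (if i = j then Q.mulVec ψ else ψ) (s i))
        (Finset.mem_univ j), if_pos rfl]
      simp only [h0, smul_eq_mul]
      rw [mul_comm, mul_assoc]
      congr 2
      exact Finset.prod_congr rfl fun i hi => by rw [if_neg (Finset.ne_of_mem_erase hi)]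
    have hc : HasDerivAt (fun θ : ℝ => (mpo N W).mulVec
        (productState N ((NormedSpace.exp ((Complex.I * θ) • Q)).mulVec ψ)))
        (Complex.I • ∑ j, (mpo N W).mulVec ((siteOp N Q j).mulVec (productState N ψ))) 0 := by
      refine hasDerivAt_pi.2 fun l => ?_
      have := HasDerivAt.fun_sum (u := Finset.univ) fun s _ => (hprod s).const_mul (mpo N W l s)
      refine this.congr_deriv ?_
      rw [← Matrix.mulVec_sum, Pi.smul_apply, Matrix.mulVec, dotProduct, Finset.smul_sum]
      refine Finset.sum_congr rfl fun s _ => ?_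
      rw [Finset.sum_apply, smul_eq_mul, ← Finset.mul_sum]
      ring
    have hmem := HasDerivAt.mem_of_forall_mem (V := deformedSpace N W U ψ) hc fun θ => by
      obtain ⟨g, hg⟩ := hQ θ
      rw [← hg]
      exact mpo_productState_mem_deformedSpace N W U ψ g
    exact ((deformedSpace N W U ψ).smul_mem_iff Complex.I_ne_zero).1 hmem
  | zero =>
    have : ∀ j, siteOp N (0 : Matrix (Fin p) (Fin p) ℂ) j = 0 := fun j => by
      simpa using siteOp_smul N (0 : ℂ) (0 : Matrix (Fin p) (Fin p) ℂ) j
    simp [this]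
  | add x y _ _ hx hy =>
    simp only [siteOp_add, Matrix.add_mulVec, Matrix.mulVec_add, Finset.sum_add_distrib]
    exact Submodule.add_mem _ hx hy
  | smul a x _ hx =>
    simp only [siteOp_smul, Matrix.smul_mulVec, Matrix.mulVec_smul, ← Finset.smul_sum]
    exact Submodule.smul_mem _ a hx

end DeformedSpace

/-! ### Expectation and variance relative to a shifted Hamiltonian. -/

section HermitianExpectations

variable {ι : Type*} [Fintype ι]

theorem star_dotProduct_self (v : ι → ℂ) : star v ⬝ᵥ v = ((star v ⬝ᵥ v).re : ℂ) := by
  have : star v ⬝ᵥ v = ((∑ i, ‖v i‖ ^ 2 : ℝ) : ℂ) := by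
    rw [dotProduct, Complex.ofReal_sum]
    refine Finset.sum_congr rfl fun i _ => ?_
    rw [Pi.star_apply, Complex.star_def, Complex.conj_mul', Complex.ofReal_pow]
  rw [this, Complex.ofReal_re]

theorem star_dotProduct_self_re_nonneg (v : ι → ℂ) : 0 ≤ (star v ⬝ᵥ v).re := by
  rw [dotProduct, Complex.re_sum]
  refine Finset.sum_nonneg fun i _ => ?_
  rw [Pi.star_apply, Complex.star_def, Complex.conj_mul', ← Complex.ofReal_pow, Complex.ofReal_re]
  positivity

theorem isHermitian_dotProduct_mulVec {H : Matrix ι ι ℂ} (hH : H.IsHermitian) (u v : ι → ℂ) :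
    star u ⬝ᵥ H.mulVec v = star (H.mulVec u) ⬝ᵥ v := by
  rw [Matrix.star_mulVec, hH.eq, Matrix.dotProduct_mulVec]

variable {H : Matrix ι ι ℂ} {v : ι → ℂ} {c : ℝ}

/-- No assumption `c ≠ 0` is needed: for `c = 0` both sides are `0`, since division by zero gives
zero. -/
theorem expectation_smul (hc : c ^ 2 = (star v ⬝ᵥ v).re) (u : ι → ℂ) (O : Matrix ι ι ℂ)
    (hu : star v ⬝ᵥ O.mulVec v = u ⬝ᵥ v) :
    expectation O ((c : ℂ)⁻¹ • v) = ((u ⬝ᵥ v) / (star v ⬝ᵥ v)).re := by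
  have h2 : star v ⬝ᵥ v = (c : ℂ) ^ 2 := by
    rw [star_dotProduct_self, ← hc, Complex.ofReal_pow]
  rw [expectation, Matrix.mulVec_smul, star_smul, smul_dotProduct, dotProduct_smul, hu, h2,
    Complex.star_def, map_inv₀, Complex.conj_ofReal, smul_eq_mul, smul_eq_mul]
  congr 1
  rw [div_eq_mul_inv, sq, mul_inv]
  ring

theorem expectation_sub_eq (hc : c ^ 2 = (star v ⬝ᵥ v).re)
    (hc0 : c ≠ 0) (E : ℝ) :
    expectation H ((c : ℂ)⁻¹ • v) - E =
      ((star v ⬝ᵥ (H.mulVec v - (E : ℂ) • v)) / (star v ⬝ᵥ v)).re := by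
  have h2 : star v ⬝ᵥ v = (c : ℂ) ^ 2 := by
    rw [star_dotProduct_self, ← hc, Complex.ofReal_pow]
  have hn : star v ⬝ᵥ v ≠ 0 := by
    rw [h2]
    exact pow_ne_zero _ (Complex.ofReal_ne_zero.2 hc0)
  rw [expectation_smul hc (Matrix.vecMul (star v) H) H (Matrix.dotProduct_mulVec _ _ _),
    dotProduct_sub, dotProduct_smul, sub_div, Complex.sub_re, smul_eq_mul,
    mul_div_cancel_right₀ _ hn, Complex.ofReal_re, Matrix.dotProduct_mulVec]

/-- The variance is unchanged under `H ↦ H - E`, and hermiticity turns the second moment of `H - E`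
into the squared norm of `(H - E) v`. The extensive energy `E₀` thus drops out before any limit. -/
theorem energyVariance_eq (hH : H.IsHermitian) (hc : c ^ 2 = (star v ⬝ᵥ v).re)
    (hc0 : c ≠ 0) (E : ℝ) :
    energyVariance H ((c : ℂ)⁻¹ • v) =
      ((star (H.mulVec v - (E : ℂ) • v) ⬝ᵥ (H.mulVec v - (E : ℂ) • v)) / (star v ⬝ᵥ v)).re -
        (expectation H ((c : ℂ)⁻¹ • v) - E) ^ 2 := by
  have h2 : star v ⬝ᵥ v = (c : ℂ) ^ 2 := by
    rw [star_dotProduct_self, ← hc, Complex.ofReal_pow]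
  have hn : star v ⬝ᵥ v ≠ 0 := by
    rw [h2]
    exact pow_ne_zero _ (Complex.ofReal_ne_zero.2 hc0)
  have h1 := expectation_smul hc (Matrix.vecMul (star v) H) H (Matrix.dotProduct_mulVec _ _ _)
  have h3 := expectation_smul hc (Matrix.vecMul (star v) (H * H)) (H * H)
    (Matrix.dotProduct_mulVec _ _ _)
  rw [← Matrix.dotProduct_mulVec] at h1 h3
  have h4 : star (H.mulVec v - (E : ℂ) • v) ⬝ᵥ (H.mulVec v - (E : ℂ) • v) =
      star v ⬝ᵥ (H * H).mulVec v - 2 * E * (star v ⬝ᵥ H.mulVec v) + E ^ 2 * (star v ⬝ᵥ v) := by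
    rw [star_sub, star_smul, sub_dotProduct, dotProduct_sub, dotProduct_sub, smul_dotProduct,
      smul_dotProduct, dotProduct_smul, dotProduct_smul, ← isHermitian_dotProduct_mulVec hH,
      ← isHermitian_dotProduct_mulVec hH, Matrix.mulVec_mulVec, Complex.star_def,
      Complex.conj_ofReal]
    simp only [smul_eq_mul]
    ring
  have h5 : (star (H.mulVec v - (E : ℂ) • v) ⬝ᵥ (H.mulVec v - (E : ℂ) • v)) / (star v ⬝ᵥ v) =
      (star v ⬝ᵥ (H * H).mulVec v) / (star v ⬝ᵥ v) -
        ((2 * E : ℝ) : ℂ) * ((star v ⬝ᵥ H.mulVec v) / (star v ⬝ᵥ v)) + ((E ^ 2 : ℝ) : ℂ) := by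
    rw [h4]
    push_cast
    field_simp
  rw [energyVariance, h5, Complex.add_re, Complex.sub_re, Complex.re_ofReal_mul, Complex.ofReal_re,
    ← h1, ← h3]
  ring

end HermitianExpectations

/-! ### From tensor replacements to local operators, and their commutators with the Hamiltonian. -/

section LocalGenerators

variable {χ d : ℕ} {A B : Fin d → Matrix (Fin χ) (Fin χ) ℂ}

/-- In an injective matrix-product state, replacing the tensor of one site amounts to acting with a
local operator. -/
theorem exists_localOp_of_isInjectiveMPS (hinj : IsInjectiveMPS A)
    (B : Fin d → Matrix (Fin χ) (Fin χ) ℂ) :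
    ∃ (L : ℕ) (O : Matrix (Fin L → Fin d) (Fin L → Fin d) ℂ),
      ∀ N, 0 < N → L ≤ N → dressedVec N A O = siteVec N A B := by
  obtain ⟨L, hL, hspan⟩ := hinj
  -- Row `u` of the operator consists of the coefficients that expand the word with `B` at its first
  -- site in words of `A`.
  have h : ∀ u : Fin L → Fin d, ∃ c : (Fin L → Fin d) → ℂ, ∑ t, c t • word A t =
      siteWord (fun i => if i = ⟨0, hL⟩ then B else A) u := fun u =>
    (Submodule.mem_span_range_iff_exists_fun ℂ).1 (by
      change _ ∈ Submodule.span ℂ (Set.range fun s : Fin L → Fin d =>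
        (List.ofFn fun i : Fin L => A (s i)).prod)
      rw [hspan]
      trivial)
  choose O hO using h
  refine ⟨L, Matrix.of O, fun N hN hLN => ?_⟩
  have h0 : dressedVec N A (Matrix.of O) ⟨0, hN⟩ = siteVec N A B ⟨0, hN⟩ := by
    obtain ⟨b, rfl⟩ := Nat.exists_eq_add_of_le hLN
    rw [dressedVec_eq_castLE A _ le_rfl _ rfl,
      localOp_mulVec_mpsVec A ((Fin.castAdd_injective L b).comp (Fin.castLE_injective _))]
    funext s
    obtain ⟨⟨u, v⟩, rfl⟩ := (Fin.appendEquiv L b).surjective s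
    change (dressedWord A (Fin.castAdd b ∘ id) (Matrix.of O) (Fin.append u v)).trace =
      (siteWord _ (Fin.append u v)).trace
    rw [dressedWord_castAdd A Function.injective_id, dressedWord_id,
      siteWord_append_left A B _ hL]
    simp only [Matrix.of_apply, hO]
  -- Covariance carries the identity from site `0` to every site.
  funext j s
  have hj : j = siteAdd ⟨0, hN⟩ j := by
    ext
    simp [siteAdd, Nat.mod_eq_of_lt j.isLt]
  rw [hj, dressedVec_isCovariant A _ hLN, siteVec_isCovariant, h0]

variable {L m : ℕ}

/-- The embedding of a window of `L` sites into a larger one, starting at site `m`. -/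
def subWindow {L M : ℕ} (m : ℕ) (hm : m + L ≤ M) (a : Fin L) : Fin M :=
  ⟨m + a, by omega⟩

theorem subWindow_injective {M : ℕ} (hm : m + L ≤ M) : Function.Injective (subWindow m hm) := by
  intro a b hab
  have := congrArg Fin.val hab
  simp only [subWindow] at this
  exact Fin.ext (by omega)

theorem siteAdd_comp_subWindow {M N : ℕ} (hm : m + L ≤ M) (j : Fin N) :
    (fun a : Fin M => siteAdd j a) ∘ subWindow m hm = fun a : Fin L => siteAdd (siteAdd j m) a := by
  funext a
  rw [siteAdd_siteAdd]
  rfl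

/-- The operator `O`, seen as an operator on a window with `m` more sites on both sides. -/
def padOp (m : ℕ) (O : Matrix (Fin L → Fin d) (Fin L → Fin d) ℂ) :
    Matrix (Fin (m + L + m) → Fin d) (Fin (m + L + m) → Fin d) ℂ :=
  localOp (subWindow m (Nat.le_add_right _ _)) O

/-- The commutator of the Hamiltonian with a local operator `O`, as a local operator. -/
def localCommutator (h : Matrix (Fin (m + 1) → Fin d) (Fin (m + 1) → Fin d) ℂ)
    (O : Matrix (Fin L → Fin d) (Fin L → Fin d) ℂ) :
    Matrix (Fin (m + L + m) → Fin d) (Fin (m + L + m) → Fin d) ℂ :=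
  -- In the padded window `O` occupies the sites `m, …, m + L - 1`. A term starting at `a` can meet
  -- them only if `a < m + L`, and it then fits into the window.
  ∑ a : Fin (m + L), (localOp (subWindow a.val (by omega)) h * padOp m O -
    padOp m O * localOp (subWindow a.val (by omega)) h)

theorem dressedVec_padOp (O : Matrix (Fin L → Fin d) (Fin L → Fin d) ℂ) {N : ℕ}
    (hN : m + L + m ≤ N) (j : Fin N) :
    dressedVec N A (padOp m O) j = dressedVec N A O (siteAdd j m) := by
  rw [dressedVec, padOp, localOp_comp_mulVec (subWindow_injective _) (window_injective hN j),
    siteAdd_comp_subWindow, dressedVec]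

theorem siteAdd_ne_of_lt {N i a b : ℕ} (j : Fin N) (h1 : b < i + a) (h2 : i + a < b + N) :
    siteAdd (siteAdd j i) a ≠ siteAdd j b := by
  intro h
  rw [siteAdd_siteAdd] at h
  have h3 := congrArg Fin.val h
  simp only [siteAdd] at h3
  have h4 : i + a ≡ b [MOD N] := Nat.ModEq.add_left_cancel' j.val h3
  have h5 := (Nat.modEq_iff_dvd' h1.le).1 h4.symm
  exact absurd (Nat.le_of_dvd (by omega) h5) (by omega)

/-- Moving `E` through the padded operator `P` and replacing `E |A⟩` by `H |A⟩` gives the sum of all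
`[h_i, P] |A⟩`. Terms disjoint from the support of `O` drop out. -/
theorem dressedVec_localCommutator
    (h : Matrix (Fin (m + 1) → Fin d) (Fin (m + 1) → Fin d) ℂ)
    (O : Matrix (Fin L → Fin d) (Fin L → Fin d) ℂ) {N : ℕ} (hN : m + L + m ≤ N) (hm : m < N)
    {E : ℂ} (hE : (hamiltonian N h).mulVec (mpsVec N A) = E • mpsVec N A) (j : Fin N) :
    dressedVec N A (localCommutator h O) j =
      (hamiltonian N h).mulVec (dressedVec N A (padOp m O) j) -
        E • dressedVec N A (padOp m O) j := by
  set P := localOp (fun a : Fin (m + L + m) => siteAdd j a) (padOp m O) with hP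
  have hw := window_injective hN j
  have hPO : ∀ v : (Fin N → Fin d) → ℂ,
      P.mulVec v = (localOp (fun a : Fin L => siteAdd (siteAdd j m) a) O).mulVec v := fun v => by
    rw [hP, padOp, localOp_comp_mulVec (subWindow_injective _) hw, siteAdd_comp_subWindow]
  have hblock : ∀ (a : Fin (m + L)) (v : (Fin N → Fin d) → ℂ),
      (localOp (fun a : Fin (m + L + m) => siteAdd j a)
        (localOp (subWindow a.val (by omega)) h)).mulVec v =
        (blockOp N h (siteAdd j a)).mulVec v := fun a v => by
    rw [localOp_comp_mulVec (subWindow_injective _) hw, siteAdd_comp_subWindow, blockOp_eq_localOp]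
  have hl : dressedVec N A (localCommutator h O) j =
      ∑ a : Fin (m + L), ((blockOp N h (siteAdd j a)).mulVec (P.mulVec (mpsVec N A)) -
        P.mulVec ((blockOp N h (siteAdd j a)).mulVec (mpsVec N A))) := by
    rw [dressedVec, localCommutator, localOp_sum, Matrix.sum_mulVec]
    refine Finset.sum_congr rfl fun a _ => ?_
    rw [localOp_sub, Matrix.sub_mulVec, localOp_mul_mulVec hw, localOp_mul_mulVec hw, hblock,
      hblock]
  have hr : (hamiltonian N h).mulVec (dressedVec N A (padOp m O) j) -
      E • dressedVec N A (padOp m O) j =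
      ∑ i : Fin N, ((blockOp N h (siteAdd j i)).mulVec (P.mulVec (mpsVec N A)) -
        P.mulVec ((blockOp N h (siteAdd j i)).mulVec (mpsVec N A))) := by
    change (hamiltonian N h).mulVec (P.mulVec (mpsVec N A)) - E • P.mulVec (mpsVec N A) = _
    rw [← Matrix.mulVec_smul, ← hE, hamiltonian, Matrix.sum_mulVec, Matrix.sum_mulVec,
      Matrix.mulVec_sum, ← Finset.sum_sub_distrib]
    exact ((Equiv.ofBijective _ (Finite.injective_iff_bijective.1
      (window_injective le_rfl j))).sum_comp fun i =>
      (blockOp N h i).mulVec (P.mulVec (mpsVec N A)) -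
        P.mulVec ((blockOp N h i).mulVec (mpsVec N A))).symm
  rw [hl, hr]
  refine Fintype.sum_of_injective (Fin.castLE (by omega)) (Fin.castLE_injective _) _ _ ?_
    fun a => rfl
  intro i hi
  have hi' : m + L ≤ i.val := by
    by_contra hlt
    exact hi ⟨⟨i.val, by omega⟩, rfl⟩
  rw [sub_eq_zero, hPO, hPO, blockOp_eq_localOp]
  -- A term starting at `i ≥ m + L` may wrap around the ring, but then reaches only the `m` padding
  -- sites on the left.
  refine localOp_commute_mulVec (window_injective (by omega) _)
    (window_injective (by omega) _) (fun a b => ?_) _ _ _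
  rw [siteAdd_siteAdd j m]
  exact siteAdd_ne_of_lt j (by omega) (by omega)

end LocalGenerators

/-! ### Limits of norm, energy and variance. -/

section Limits

variable {G : Type*} [Group G] {χ d p m : ℕ} {U : G →* Matrix.unitaryGroup (Fin p) ℂ}
  {ψ : Fin p → ℂ} {q : Matrix (Fin p) (Fin p) ℂ} {W : Fin d → Fin p → Matrix (Fin χ) (Fin χ) ℂ}
  {A B : Fin d → Matrix (Fin χ) (Fin χ) ℂ}

theorem twistedVec_eq_fourierVec (hA : A = mpsTensor W ψ) (hB : B = mpsTensor W (q.mulVec ψ))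
    (N : ℕ) (k : ℝ) : twistedVec N W ψ q k = fourierVec k (siteVec N A B) := by
  rw [twistedVec, fourierVec]
  refine Finset.sum_congr rfl fun j _ => ?_
  rw [mpo_mulVec_siteOp, hA, hB, ← Complex.exp_nat_mul]
  congr 2
  ring

theorem tendsto_twistedVec_dotProduct_self (hA : A = mpsTensor W ψ)
    (hB : B = mpsTensor W (q.mulVec ψ)) (R : DominantResolution (transfer A A)) {κ : ℕ → ℝ} {k : ℝ}
    (hκ : ∀ᶠ N in atTop, κ N ∈ momenta N) (hk : Tendsto κ atTop (𝓝 k)) :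
    Tendsto (fun N : ℕ => (star (twistedVec N W ψ q (κ N)) ⬝ᵥ twistedVec N W ψ q (κ N)) / N) atTop
      (𝓝 (normDensitySq A B R k)) := by
  obtain ⟨C, ρ, h⟩ := site_clusters B R
  simp only [twistedVec_eq_fourierVec hA hB, ← ringSum_eq_normDensitySq]
  refine h.tendsto_dotProduct_fourierVec (Eventually.of_forall (siteVec_isCovariant A B))
    (Eventually.of_forall (siteVec_isCovariant A B)) ?_ ?_ hk
  · filter_upwards [hκ, eventually_ne_atTop 0] with N hN h0
    exact exp_pow_of_mem_momenta h0 hN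
  · filter_upwards [hκ, eventually_ne_atTop 0] with N hN h0 h1
    exact absurd h1 (exp_ne_one_of_mem_momenta h0 hN)

theorem continuous_normDensitySq (R : DominantResolution (transfer A A)) :
    Continuous (normDensitySq A B R) := by
  obtain ⟨C, ρ, h⟩ := site_clusters B R
  rw [← funext (ringSum_eq_normDensitySq B R)]
  exact h.continuous_ringSum

theorem tendsto_normalization (hA : A = mpsTensor W ψ) (hB : B = mpsTensor W (q.mulVec ψ))
    (R : DominantResolution (transfer A A)) {κ : ℕ → ℝ} {k : ℝ}
    (hκ : ∀ᶠ N in atTop, κ N ∈ momenta N) (hk : Tendsto κ atTop (𝓝 k)) :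
    Tendsto (fun N => normalization N W ψ q (κ N) / Real.sqrt N) atTop
      (𝓝 (Real.sqrt (normDensitySq A B R k).re)) := by
  have h := (Complex.continuous_re.tendsto _).comp
    (tendsto_twistedVec_dotProduct_self hA hB R hκ hk)
  refine ((Real.continuous_sqrt.tendsto _).comp h).congr fun N => ?_
  simp only [Function.comp_apply]
  rw [Complex.div_natCast_re, Real.sqrt_div' _ (Nat.cast_nonneg N), normalization]

/-- Both properties are inherited from squared norms divided by `N`, along a sequence of nonzero
momenta tending to `k`. -/
theorem normDensitySq_im_eq_zero_and_re_nonneg (hA : A = mpsTensor W ψ)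
    (hB : B = mpsTensor W (q.mulVec ψ)) (R : DominantResolution (transfer A A)) (k : ℝ) :
    (normDensitySq A B R k).im = 0 ∧ 0 ≤ (normDensitySq A B R k).re := by
  obtain ⟨κ, hκ, hk⟩ := exists_momenta_tendsto k
  have h := tendsto_twistedVec_dotProduct_self hA hB R hκ hk
  constructor
  · refine tendsto_nhds_unique ((Complex.continuous_im.tendsto _).comp h)
      (tendsto_const_nhds.congr fun N => ?_)
    rw [Function.comp_apply, Complex.div_natCast_im, star_dotProduct_self, Complex.ofReal_im,
      zero_div]
  · refine ge_of_tendsto' ((Complex.continuous_re.tendsto _).comp h) fun N => ?_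
    rw [Function.comp_apply, Complex.div_natCast_re]
    exact div_nonneg (star_dotProduct_self_re_nonneg _) (Nat.cast_nonneg N)

variable {h : Matrix (Fin (m + 1) → Fin d) (Fin (m + 1) → Fin d) ℂ} {E₀ : ℕ → ℝ}

theorem hamiltonian_isHermitian (hh : h.IsHermitian) (N : ℕ) : (hamiltonian N h).IsHermitian := by
  have : ∀ i : Fin N, (blockOp N h i).conjTranspose = blockOp N h i := fun i => by
    rw [blockOp_eq_localOp]
    exact localOp_isHermitian _ hh
  rw [Matrix.IsHermitian, hamiltonian, Matrix.conjTranspose_sum]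
  exact Finset.sum_congr rfl fun i _ => this i

theorem mulVec_fourierVec_sub {ι : Type*} {N : ℕ} [Fintype ι]
    (H : Matrix (Fin N → ι) (Fin N → ι) ℂ) (E : ℂ) (k : ℝ) (V : Fin N → (Fin N → ι) → ℂ) :
    H.mulVec (fourierVec k V) - E • fourierVec k V =
      fourierVec k fun j => H.mulVec (V j) - E • V j := by
  simp only [fourierVec, Matrix.mulVec_sum, Finset.smul_sum, ← Finset.sum_sub_distrib,
    Matrix.mulVec_smul, smul_sub, smul_comm E]

/-- Acting with the shifted Hamiltonian on a twisted state gives a twisted state again. -/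
theorem exists_localOps (hq : q ∈ complexLieAlgebra U) (hA : A = mpsTensor W ψ)
    (hB : B = mpsTensor W (q.mulVec ψ)) (hinj : IsInjectiveMPS A) (hh : h.IsHermitian)
    (hscar : ∀ N, m < N → ∀ v ∈ deformedSpace N W U ψ,
      (hamiltonian N h).mulVec v = (E₀ N : ℂ) • v) :
    ∃ (M : ℕ) (O K : Matrix (Fin M → Fin d) (Fin M → Fin d) ℂ), ∀ N, m < N → M ≤ N →
      (∀ k : ℝ, Complex.exp (Complex.I * k) ^ N = 1 → ∃ w : ℂ, star w * w = 1 ∧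
        fourierVec k (siteVec N A B) = w • fourierVec k (dressedVec N A O) ∧
        (hamiltonian N h).mulVec (fourierVec k (siteVec N A B)) -
          (E₀ N : ℂ) • fourierVec k (siteVec N A B) = w • fourierVec k (dressedVec N A K)) ∧
      fourierVec 0 (dressedVec N A K) = 0 ∧
      ∀ j, star (mpsVec N A) ⬝ᵥ dressedVec N A K j = 0 := by
  obtain ⟨L, O, hO⟩ := exists_localOp_of_isInjectiveMPS hinj B
  refine ⟨m + L + m, padOp m O, localCommutator h O, fun N hm hN => ?_⟩
  have hE : (hamiltonian N h).mulVec (mpsVec N A) = (E₀ N : ℂ) • mpsVec N A := by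
    rw [hA]
    exact hscar N hm _ (mpsVec_mem_deformedSpace N W U ψ)
  have hK := fun j => dressedVec_localCommutator (A := A) h O hN hm hE j
  have hpad : ∀ j : Fin N, dressedVec N A (padOp m O) j = siteVec N A B (siteAdd j m) := fun j => by
    rw [dressedVec_padOp O hN, hO N (by omega) (by omega)]
  have hw : ∀ k : ℝ, Complex.exp (Complex.I * k) ^ N = 1 → ∃ w : ℂ, star w * w = 1 ∧
        fourierVec k (siteVec N A B) = w • fourierVec k (dressedVec N A (padOp m O)) ∧
        (hamiltonian N h).mulVec (fourierVec k (siteVec N A B)) -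
          (E₀ N : ℂ) • fourierVec k (siteVec N A B) =
          w • fourierVec k (dressedVec N A (localCommutator h O)) := fun k hk => by
    -- Padding displaces the insertion by `m` sites relative to the start of the window; at momentum
    -- `k` this is a phase.
    refine ⟨Complex.exp (Complex.I * k) ^ m, ?_, ?_, ?_⟩
    · rw [Complex.star_def, Complex.conj_mul', norm_pow, norm_exp_I_mul]
      simp
    · rw [fourierVec_shift hk m]
      simp only [← hpad]
    · rw [fourierVec_shift hk m, Matrix.mulVec_smul, smul_comm (E₀ N : ℂ), ← smul_sub,
        mulVec_fourierVec_sub]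
      simp only [← hpad, ← hK]
  refine ⟨hw, ?_, fun j => ?_⟩
  · obtain ⟨w, hw1, -, hw2⟩ := hw 0 (by simp)
    -- The scar hypothesis applies to the untwisted superposition, so its image under `H - E₀`
    -- vanishes.
    have hmem : fourierVec 0 (siteVec N A B) ∈ deformedSpace N W U ψ := by
      have := sum_siteOp_mem_deformedSpace N W U ψ hq
      simp only [mpo_mulVec_siteOp, ← hA, ← hB] at this
      simpa [fourierVec] using this
    rw [hscar N hm _ hmem, sub_self] at hw2
    have hw0 : w ≠ 0 := by
      rintro rfl
      simp at hw1
    exact (smul_eq_zero.1 hw2.symm).resolve_left hw0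
  · rw [hK, dotProduct_sub, isHermitian_dotProduct_mulVec (hamiltonian_isHermitian hh N), hE,
      star_smul, smul_dotProduct, dotProduct_smul, Complex.star_def, Complex.conj_ofReal, sub_self]

/-- Vanishing one-point functions of `Y` remove the disconnected part. Then `F 0` is also the limit
along the constant momentum `0`, where the overlaps are zero by the second condition. -/
theorem exists_tendsto_dotProduct {M : ℕ} (R : DominantResolution (transfer A A))
    (X Y : Matrix (Fin M → Fin d) (Fin M → Fin d) ℂ) :
    ∃ F : ℝ → ℂ, Continuous F ∧
      (∀ (k : ℝ) (κ : ℕ → ℝ), (∀ᶠ N in atTop, κ N ∈ momenta N) → Tendsto κ atTop (𝓝 k) →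
        Tendsto (fun N : ℕ => (star (fourierVec (κ N) (dressedVec N A X)) ⬝ᵥ
          fourierVec (κ N) (dressedVec N A Y)) / N) atTop (𝓝 (F k))) ∧
      ((∀ᶠ N in atTop, ∀ i, star (mpsVec N A) ⬝ᵥ dressedVec N A Y i = 0) →
        (∀ᶠ N in atTop, fourierVec 0 (dressedVec N A Y) = 0) → F 0 = 0) := by
  obtain ⟨c, Gp, Gm, C, ρ, hcl, hc⟩ := dressed_clusters A X Y R
  have hX : ∀ᶠ N in atTop, IsCovariant (dressedVec N A X) := by
    filter_upwards [eventually_ge_atTop M] with N hN using dressedVec_isCovariant A X hN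
  have hY : ∀ᶠ N in atTop, IsCovariant (dressedVec N A Y) := by
    filter_upwards [eventually_ge_atTop M] with N hN using dressedVec_isCovariant A Y hN
  refine ⟨ringSum Gp Gm c, hcl.continuous_ringSum, fun k κ hκ hk => ?_, fun h0 h1 => ?_⟩
  · refine hcl.tendsto_dotProduct_fourierVec hX hY ?_ ?_ hk
    · filter_upwards [hκ, eventually_ne_atTop 0] with N hN h0
      exact exp_pow_of_mem_momenta h0 hN
    · filter_upwards [hκ, eventually_ne_atTop 0] with N hN h0 h1
      exact absurd h1 (exp_ne_one_of_mem_momenta h0 hN)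
  · have h := hcl.tendsto_dotProduct_fourierVec hX hY (κ := fun _ => 0) (k := 0)
      (Eventually.of_forall fun N => by simp) (Eventually.of_forall fun _ _ => hc h0)
      tendsto_const_nhds
    refine tendsto_nhds_unique h (tendsto_const_nhds.congr' ?_)
    filter_upwards [h1] with N h1
    rw [h1, dotProduct_zero, zero_div]

theorem exists_energy_limits (hq : q ∈ complexLieAlgebra U) (hA : A = mpsTensor W ψ)
    (hB : B = mpsTensor W (q.mulVec ψ)) (hinj : IsInjectiveMPS A)
    (R : DominantResolution (transfer A A)) (hh : h.IsHermitian)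
    (hscar : ∀ N, m < N → ∀ v ∈ deformedSpace N W U ψ,
      (hamiltonian N h).mulVec v = (E₀ N : ℂ) • v) :
    ∃ ε δsq : ℝ → ℝ,
      ContinuousOn ε {k | normDensitySq A B R k ≠ 0} ∧
      ContinuousOn δsq {k | normDensitySq A B R k ≠ 0} ∧
      (∀ k : ℝ, normDensitySq A B R k ≠ 0 →
        ∀ κ : ℕ → ℝ, (∀ᶠ N in atTop, κ N ∈ momenta N) → Tendsto κ atTop (𝓝 k) →
          Tendsto (fun N => expectation (hamiltonian N h) (twistedState N W ψ q (κ N)) - E₀ N)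
            atTop (𝓝 (ε k)) ∧
          Tendsto (fun N => energyVariance (hamiltonian N h) (twistedState N W ψ q (κ N)))
            atTop (𝓝 (δsq k))) ∧
      ε 0 = 0 ∧ δsq 0 = 0 := by
  obtain ⟨M, O, K, hOK⟩ := exists_localOps hq hA hB hinj hh hscar
  obtain ⟨F, hFc, hF, hF0⟩ := exists_tendsto_dotProduct R O K
  obtain ⟨F', hFc', hF', hF0'⟩ := exists_tendsto_dotProduct R K K
  have hlarge : ∀ᶠ N in atTop, m < N ∧ M ≤ N :=
    (eventually_gt_atTop m).and (eventually_ge_atTop M)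
  have hone : ∀ᶠ N in atTop, ∀ i, star (mpsVec N A) ⬝ᵥ dressedVec N A K i = 0 :=
    hlarge.mono fun N hN => (hOK N hN.1 hN.2).2.2
  have hzero : ∀ᶠ N in atTop, fourierVec 0 (dressedVec N A K) = 0 :=
    hlarge.mono fun N hN => (hOK N hN.1 hN.2).2.1
  have hD := continuous_normDensitySq (B := B) R
  have hε : ContinuousOn (fun k => (F k / normDensitySq A B R k).re)
      {k | normDensitySq A B R k ≠ 0} :=
    Complex.continuous_re.comp_continuousOn
      (hFc.continuousOn.div hD.continuousOn fun k hk => hk)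
  have hδ : ContinuousOn (fun k => (F' k / normDensitySq A B R k).re)
      {k | normDensitySq A B R k ≠ 0} :=
    Complex.continuous_re.comp_continuousOn
      (hFc'.continuousOn.div hD.continuousOn fun k hk => hk)
  -- `F` and `F'` are the limits per site of `⟨v|(H - E₀)|v⟩` and `‖(H - E₀) v‖²` for the
  -- unnormalized twisted vector `v`; the factors `N` cancel against its squared norm.
  refine ⟨fun k => (F k / normDensitySq A B R k).re, fun k => (F' k / normDensitySq A B R k).re -
    (F k / normDensitySq A B R k).re ^ 2, hε, hδ.sub (hε.pow 2), fun k hDk κ hκ hk => ?_, ?_, ?_⟩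
  · have hn := tendsto_twistedVec_dotProduct_self hA hB R hκ hk
    have hn0 : ∀ᶠ N : ℕ in atTop, normalization N W ψ q (κ N) ≠ 0 := by
      filter_upwards [hn.eventually_ne hDk] with N hN h0
      refine hN ?_
      rw [normalization, Real.sqrt_eq_zero (star_dotProduct_self_re_nonneg _)] at h0
      rw [star_dotProduct_self, h0]
      simp
    have hsq : ∀ N, normalization N W ψ q (κ N) ^ 2 =
        (star (twistedVec N W ψ q (κ N)) ⬝ᵥ twistedVec N W ψ q (κ N)).re := fun N =>
      Real.sq_sqrt (star_dotProduct_self_re_nonneg _)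
    have hdiv : ∀ (N : ℕ), N ≠ 0 → ∀ x y : ℂ, x / N / (y / N) = x / y := fun N hN x y =>
      div_div_div_cancel_right₀ (Nat.cast_ne_zero.2 hN) _ _
    have hlim1 : Tendsto (fun N => expectation (hamiltonian N h) (twistedState N W ψ q (κ N)) -
        E₀ N) atTop (𝓝 (F k / normDensitySq A B R k).re) := by
      refine ((Complex.continuous_re.tendsto _).comp ((hF k κ hκ hk).div hn hDk)).congr' ?_
      filter_upwards [hlarge, hκ, hn0, eventually_ne_atTop 0] with N hN hκN hn0 hN0
      obtain ⟨w, hw, h1, h2⟩ := (hOK N hN.1 hN.2).1 (κ N) (exp_pow_of_mem_momenta hN0 hκN)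
      rw [twistedState, expectation_sub_eq (hsq N) hn0]
      simp only [Function.comp_apply, Pi.div_apply, hdiv N hN0]
      congr 2
      rw [twistedVec_eq_fourierVec hA hB, h2, h1, star_smul, smul_dotProduct, dotProduct_smul,
        smul_smul, hw, one_smul]
    refine ⟨hlim1, ?_⟩
    refine Tendsto.congr' ?_ (((Complex.continuous_re.tendsto _).comp
      ((hF' k κ hκ hk).div hn hDk)).sub (hlim1.pow 2))
    filter_upwards [hlarge, hκ, hn0, eventually_ne_atTop 0] with N hN hκN hn0 hN0
    obtain ⟨w, hw, h1, h2⟩ := (hOK N hN.1 hN.2).1 (κ N) (exp_pow_of_mem_momenta hN0 hκN)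
    rw [twistedState, energyVariance_eq (hamiltonian_isHermitian hh N) (hsq N) hn0 (E₀ N)]
    simp only [Function.comp_apply, Pi.div_apply, hdiv N hN0]
    congr 3
    rw [twistedVec_eq_fourierVec hA hB, h2, star_smul, smul_dotProduct, dotProduct_smul,
      smul_smul, hw, one_smul]
  · simp [hF0 hone hzero]
  · simp [hF0 hone hzero, hF0' hone hzero]

end Limits

end DeformedScar

end

/-! ### The deformed quasi-Nambu–Goldstone theorem. -/

theorem mainTheorem2
    {G : Type*} [Group G] {χ d p m : ℕ}
    (U : G →* Matrix.unitaryGroup (Fin p) ℂ)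
    (ψ : Fin p → ℂ)
    (q : Matrix (Fin p) (Fin p) ℂ) (hq : q ∈ DeformedScar.complexLieAlgebra U)
    (W : Fin d → Fin p → Matrix (Fin χ) (Fin χ) ℂ)
    (A B : Fin d → Matrix (Fin χ) (Fin χ) ℂ)
    (hA : A = DeformedScar.mpsTensor W ψ)
    (hB : B = DeformedScar.mpsTensor W (q.mulVec ψ))
    (hinj : DeformedScar.IsInjectiveMPS A)
    (R : DeformedScar.DominantResolution (DeformedScar.transfer A A))
    (h : Matrix (Fin (m + 1) → Fin d) (Fin (m + 1) → Fin d) ℂ) (hh : h.IsHermitian)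
    (E₀ : ℕ → ℝ)
    (hscar : ∀ N, m < N → ∀ v ∈ DeformedScar.deformedSpace N W U ψ,
      (DeformedScar.hamiltonian N h).mulVec v = (E₀ N : ℂ) • v) :
    -- the normalization is `√N` times a finite tensor contraction
    (Continuous (DeformedScar.normDensitySq A B R) ∧
      (∀ k : ℝ, (DeformedScar.normDensitySq A B R k).im = 0 ∧
        0 ≤ (DeformedScar.normDensitySq A B R k).re) ∧
      ∀ (k : ℝ) (κ : ℕ → ℝ), (∀ᶠ N in atTop, κ N ∈ DeformedScar.momenta N) →
        Tendsto κ atTop (𝓝 k) →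
        Tendsto (fun N => DeformedScar.normalization N W ψ q (κ N) / Real.sqrt N) atTop
          (𝓝 (Real.sqrt (DeformedScar.normDensitySq A B R k).re))) ∧
    -- energy and variance in the thermodynamic limit
    ∃ ε δsq : ℝ → ℝ,
      ContinuousOn ε {k | DeformedScar.normDensitySq A B R k ≠ 0} ∧
      ContinuousOn δsq {k | DeformedScar.normDensitySq A B R k ≠ 0} ∧
      (∀ k : ℝ, DeformedScar.normDensitySq A B R k ≠ 0 →
        ∀ κ : ℕ → ℝ, (∀ᶠ N in atTop, κ N ∈ DeformedScar.momenta N) →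
          Tendsto κ atTop (𝓝 k) →
          Tendsto (fun N => DeformedScar.expectation (DeformedScar.hamiltonian N h)
            (DeformedScar.twistedState N W ψ q (κ N)) - E₀ N) atTop (𝓝 (ε k)) ∧
          Tendsto (fun N => DeformedScar.energyVariance (DeformedScar.hamiltonian N h)
            (DeformedScar.twistedState N W ψ q (κ N))) atTop (𝓝 (δsq k))) ∧
      (DeformedScar.normDensitySq A B R 0 ≠ 0 →
        Tendsto ε (𝓝 0) (𝓝 0) ∧ Tendsto δsq (𝓝 0) (𝓝 0)) := by
  refine ⟨⟨DeformedScar.continuous_normDensitySq R,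
    DeformedScar.normDensitySq_im_eq_zero_and_re_nonneg hA hB R,
    fun k κ hκ hk => DeformedScar.tendsto_normalization hA hB R hκ hk⟩, ?_⟩
  obtain ⟨ε, δsq, hε, hδ, hlim, hε0, hδ0⟩ :=
    DeformedScar.exists_energy_limits hq hA hB hinj R hh hscar
  refine ⟨ε, δsq, hε, hδ, hlim, fun h0 => ?_⟩
  -- The domain is open, so continuity on it is continuity at `0`, where both functions vanish.
  have hopen : IsOpen {k | DeformedScar.normDensitySq A B R k ≠ 0} :=
    isOpen_ne_fun (DeformedScar.continuous_normDensitySq R) continuous_const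
  have h1 := (hε.continuousAt (hopen.mem_nhds h0)).tendsto
  have h2 := (hδ.continuousAt (hopen.mem_nhds h0)).tendsto
  rw [hε0] at h1
  rw [hδ0] at h2
  exact ⟨h1, h2⟩
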